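/- Let $d\in\{1,2,3\}$ and $c>0$, and let $X_S := L^2(\mathbb{R}\times S^{d-1};\mathbb{C})$, where $S^{d-1}\subset\mathbb{R}^d$ is the unit sphere with its surface measure (counting measure if $d=1$). Let $V=V(z,q,\tau)$, $V\in L^\infty(0,\infty;X_S)$, be a profile given at every time $\tau>0$, and let $\hat V(\xi,q,\tau) := \int_{\mathbb{R}} V(z,q,\tau)e^{-i\xi z}\,dz$ be its Fourier transform in $z$. Assume: (i) there are $C,\alpha>0$ such that for every $\tau>0$ and $q\in S^{d-1}$ one has $|V(z,q,\tau)|\le C(1+|z|)^{-d-\alpha}$ for almost every $z\in\mathbb{R}$; (ii) for every $\tau>0$ the function $(\xi,q)\mapsto \hat V(\xi,q,\tau)$ is of class $C^{d-1}(\mathbb{R}\times S^{d-1};\mathbb{C})$; (iii) $\hat V(\xi,q,\tau)=0$ for all $\xi<0$, $q\in S^{d-1}$, $\tau>0$. For $\varepsilon>0$ define the shell operator $$(\mathcal{S}V)(x,t) := \frac{1}{(ct)^{(d-1)/2}}\,\mathbf{1}_{\{|x|<2ct\}}\,V\Big(|x|-ct,\frac{x}{|x|},\varepsilon^2t\Big),\qquad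 x\in\mathbb{R}^d\setminus\{0\},\ t>0,$$ and let $(\mathcal{F}_d u)(k)=\int_{\mathbb{R}^d}u(x)e^{-ik\cdot x}\,dx$. Then, for every $\tau>0$, the function $\mathcal{S}V(\cdot,\tau/\varepsilon^2)$ is integrable on $\mathbb{R}^d$ for every $\varepsilon>0$, and for every $k\in\mathbb{R}^d\setminus\{0\}$ $$(\mathcal{F}_d\circ\mathcal{S})(V)(k,\tau/\varepsilon^2)\,e^{ic|k|\tau/\varepsilon^2}\;\longrightarrow\;\Big(\frac{|k|}{2\pi i}\Big)^{-(d-1)/2}\hat V\Big(|k|,\frac{k}{|k|},\tau\Big)\qquad\text{as }\varepsilon\to0^+,$$ where the complex power is the principal branch. Moreover, for every $\tau>0$, as functions of $k$ both sides belong to $L^2(\mathbb{R}^d)$ and the convergence also holds weakly in $L^2(\mathbb{R}^d)$. -/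

import Mathlib

open MeasureTheory Filter Set
open scoped Topology Manifold ContDiff

noncomputable section

namespace WaveShell

/-- Euclidean space `ℝ^d`. -/
abbrev Space (d : ℕ) : Type := EuclideanSpace ℝ (Fin d)

/-- The unit sphere `S^{d-1} ⊂ ℝ^d`. -/
abbrev Sphere (d : ℕ) : Type := Metric.sphere (0 : Space d) 1

/-- The dimension fact that activates Mathlib's smooth manifold structure on `S^{d-1}`. -/
instance finrankFact (d : ℕ) [NeZero d] :
    Fact (Module.finrank ℝ (Space d) = (d - 1) + 1) :=
  ⟨by
    rw [finrank_euclideanSpace_fin]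
    exact (Nat.succ_pred_eq_of_pos (Nat.pos_of_ne_zero (NeZero.ne d))).symm⟩

/-- The surface measure `dS` on `S^{d-1}` (for `d = 1`, the counting measure on two points). -/
def surfaceMeasure (d : ℕ) : Measure (Sphere d) := (volume : Measure (Space d)).toSphere

/-- The product measure `dz dS(q)` on `ℝ × S^{d-1}`. -/
def profileMeasure (d : ℕ) : Measure (ℝ × Sphere d) :=
  (volume : Measure ℝ).prod (surfaceMeasure d)

/-- The direction `x / |x| ∈ S^{d-1}` of a nonzero vector `x`. -/
def direction {d : ℕ} (x : Space d) (hx : x ≠ 0) : Sphere d :=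
  ⟨‖x‖⁻¹ • x, by simp [norm_smul, hx]⟩

/-- `V ∈ L^∞(0,∞; L²(ℝ × S^{d-1}; ℂ))`, for a profile `V = V(z,q,τ)` that is given at every
time `τ > 0`: the time slices are square integrable, `τ ↦ V(·,·,τ)` is strongly measurable as a
map into `L²` (up to null sets of times), and its norm is essentially bounded. -/
def IsProfileEvolution {d : ℕ} (V : ℝ → Sphere d → ℝ → ℂ) : Prop :=
  ∃ h : ∀ τ : Ioi (0 : ℝ), MemLp (fun p : ℝ × Sphere d => V p.1 p.2 τ) 2 (profileMeasure d),
    MemLp (fun τ : Ioi (0 : ℝ) => (h τ).toLp) ⊤ (volume.comap Subtype.val)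

/-- The one-dimensional Fourier transform in `z` of a profile,
`V̂(ξ,q,τ) = ∫ V(z,q,τ) e^{-iξz} dz`. -/
def profileFourier {d : ℕ} (V : ℝ → Sphere d → ℝ → ℂ) (ξ : ℝ) (q : Sphere d) (τ : ℝ) : ℂ :=
  ∫ z : ℝ, V z q τ * Complex.exp (-(Complex.I * ξ * z))

/-- The `d`-dimensional Fourier transform `û(k) = ∫ u(x) e^{-ik·x} dx`. -/
def spaceFourier {d : ℕ} (u : Space d → ℂ) (k : Space d) : ℂ :=
  ∫ x : Space d, u x * Complex.exp (-(Complex.I * (inner ℝ k x : ℝ)))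

/-- The shell operator
`(S V)(x,t) = (ct)^{-(d-1)/2} 1_{|x| < 2ct} V(|x| - ct, x/|x|, ε² t)`
with wave speed `c` and scaling parameter `ε`; the value at the single point `x = 0` is set
to be `0`. -/
def shell {d : ℕ} (c ε : ℝ) (V : ℝ → Sphere d → ℝ → ℂ) (x : Space d) (t : ℝ) : ℂ :=
  open scoped Classical in
  if hx : x ≠ 0 then
    if ‖x‖ < 2 * c * t then
      (1 / ((c * t) ^ (((d : ℝ) - 1) / 2) : ℝ) : ℂ) *
        V (‖x‖ - c * t) (direction x hx) (ε ^ 2 * t)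
    else 0
  else 0

/-- The growth and smoothness assumption on profiles: `V ∈ L^∞(0,∞; L²(ℝ × S^{d-1}))`, `V` decays
in `z` like `(1+|z|)^{-d-α}` uniformly in `q` and `τ`, and `V̂(·,·,τ)` is of class `C^{d-1}` on the
manifold `ℝ × S^{d-1}` for every `τ > 0`. -/
structure ProfileAssumption {d : ℕ} [NeZero d] (V : ℝ → Sphere d → ℝ → ℂ) : Prop where
  isProfileEvolution : IsProfileEvolution V
  decay : ∃ C α : ℝ, 0 < C ∧ 0 < α ∧ ∀ τ : ℝ, 0 < τ → ∀ q : Sphere d,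
    ∀ᵐ z : ℝ, ‖V z q τ‖ ≤ C * (1 + |z|) ^ (-(d : ℝ) - α)
  smooth : ∀ τ : ℝ, 0 < τ →
    ContMDiff (𝓘(ℝ, ℝ).prod (𝓡 (d - 1))) 𝓘(ℝ, ℂ) ((d - 1 : ℕ) : ℕ∞)
      (fun p : ℝ × Sphere d => profileFourier V p.1 p.2 τ)

/-- The rescaled reconstruction `k ↦ (F_d ∘ S)(V)(k, τ/ε²) e^{ic|k|τ/ε²}` in Fourier space. -/
def shellFourier {d : ℕ} (c ε : ℝ) (V : ℝ → Sphere d → ℝ → ℂ) (τ : ℝ) (k : Space d) : ℂ :=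
  spaceFourier (fun x => shell c ε V x (τ / ε ^ 2)) k *
    Complex.exp (Complex.I * c * ‖k‖ * τ / ε ^ 2)

/-- The function `k ↦ (|k|/(2πi))^{-(d-1)/2} V̂(|k|, k/|k|, τ)`, with the principal branch of the
complex power; the value at the single point `k = 0` is set to be `0`. -/
def shellLimit {d : ℕ} (V : ℝ → Sphere d → ℝ → ℂ) (τ : ℝ) (k : Space d) : ℂ :=
  open scoped Classical in
  if hk : k ≠ 0 then
    ((‖k‖ : ℂ) / (2 * Real.pi * Complex.I)) ^ (-(((d : ℂ) - 1) / 2)) *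
      profileFourier V ‖k‖ (direction k hk) τ
  else 0

/-- Weak convergence in `L²(ℝ^d; ℂ)` of a family `F ε` as `ε → 0`, `ε > 0`: all functions are
square integrable and the pairings with every square integrable function converge. -/
def WeaklyConvergesL2 {d : ℕ} (F : ℝ → Space d → ℂ) (G : Space d → ℂ) : Prop :=
  (∀ ε : ℝ, 0 < ε → MemLp (F ε) 2 volume) ∧ MemLp G 2 volume ∧
    ∀ f : Space d → ℂ, MemLp f 2 volume →
      Tendsto (fun ε : ℝ => ∫ k, F ε k * f k) (𝓝[>] 0) (𝓝 (∫ k, G k * f k))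

end WaveShell

end

/-! Put T = ct = cτ/ε² and use the coordinates z = |x| - T, q = x/|x|, in which dx = (z+T)^(d-1) dz
dS(q). The Fourier transform of the shell becomes T^((d-1)/2) times the integral of w_T(z) V(z,q,τ)
e^{-i(z+T)k·q} over ℝ × S^{d-1}, where w_T(z) = (1+z/T)^(d-1) for |z| < T and 0 otherwise
(`spaceFourier_shell`).

The weight w_T may be replaced by 1 with error o(T^{-(d-1)/2}). For d = 1 this is dominated
convergence. For d = 2 a first moment of V suffices. For d = 3 the quadratic remainder is controlled
by a second moment, but the linear term 2z/T is exactly of the critical order, and its contribution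
vanishes by Riemann–Lebesgue on the sphere. The decay of V provides the d-1 moments needed.

The z-integral then produces V̂(k·q,q,τ) and leaves T^((d-1)/2) ∫ e^{-iTk·q} V̂(k·q,q,τ) dS(q). The
phase is stationary at q = ±k/|k|; absence of negative frequencies removes the antipodal point, and
the factor e^{ic|k|τ/ε²} cancels the oscillation at the other. For d = 1 the sphere integral is a
sum over two points. For d = 2 stationary phase reduces it to the Fresnel integral
(`tendsto_stationaryPhase`). For d = 3 one integration by parts in the colatitude leaves a boundary
term at k/|k| and a Riemann–Lebesgue remainder (`tendsto_integral_sin_exp_cos`).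

Weak convergence is soft: the shells are bounded in L² uniformly in ε (`eLpNorm_shellProfile_le`),
Plancherel carries the bound to Fourier space, and an L²-bounded family converging almost everywhere
converges weakly (`weak_tendsto_of_ae_tendsto`). -/

noncomputable section

namespace WaveShell

/-! ### Plancherel for Fourier integrals, and weak convergence in L². -/

section L2

open scoped FourierTransform ENNReal

/-- For an integrable and square integrable function the Fourier integral is a representative of
the `L²` Fourier transform. -/
theorem fourier_ae_eq_toLp {d : ℕ} {f : Space d → ℂ} (h1 : Integrable f) (h2 : MemLp f 2 volume) :
    𝓕 f =ᵐ[volume] (𝓕 (h2.toLp f) : Lp ℂ 2 (volume : Measure (Space d))) := by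
  have hcont : Continuous (𝓕 f) :=
    VectorFourier.fourierIntegral_continuous Real.continuous_fourierChar
      (by exact continuous_inner) h1
  -- Both sides are compared by pairing with test functions: the L² transform acts by duality as a
  -- tempered distribution, and the Fourier integral can be moved across the pairing by Fubini.
  refine ae_eq_of_integral_contDiff_smul_eq hcont.locallyIntegrable
    ((Lp.memLp _).locallyIntegrable (by norm_num)) fun g hg hgc => ?_
  have hg' : ContDiff ℝ ∞ (fun x => (g x : ℂ)) := Complex.ofRealCLM.contDiff.comp hg
  have hgc' : HasCompactSupport (fun x => (g x : ℂ)) := hgc.comp_left (g := Complex.ofReal) rfl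
  let φ : SchwartzMap (Space d) ℂ := hgc'.toSchwartzMap hg'
  have hφ : ∀ x, φ x = (g x : ℂ) := fun x => rfl
  have key := congrArg (fun D => D φ) (Lp.fourier_toTemperedDistribution_eq (h2.toLp f))
  simp only [TemperedDistribution.fourier_apply, Lp.toTemperedDistribution_apply] at key
  have e1 : ∫ x, (𝓕 φ) x • (h2.toLp f) x = ∫ x, (𝓕 (φ : Space d → ℂ)) x • f x := by
    refine integral_congr_ae ?_
    filter_upwards [h2.coeFn_toLp] with x hx
    rw [hx, SchwartzMap.fourier_coe]
  have e2 : ∫ x, (𝓕 (φ : Space d → ℂ)) x • f x = ∫ x, φ x • 𝓕 f x := by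
    have := VectorFourier.integral_fourierIntegral_smul_eq_flip (L := innerₗ (Space d))
      (μ := volume) (ν := volume) Real.continuous_fourierChar
      (by exact continuous_inner) φ.integrable h1
    rw [flip_innerₗ] at this
    exact this
  rw [e1, e2] at key
  simpa [hφ, Complex.real_smul] using key

/-- Plancherel's inequality for integrable and square integrable functions. -/
theorem memLp_fourier {d : ℕ} {f : Space d → ℂ} (h1 : Integrable f) (h2 : MemLp f 2 volume) :
    MemLp (𝓕 f) 2 volume ∧ eLpNorm (𝓕 f) 2 volume = eLpNorm f 2 volume := by
  have h := fourier_ae_eq_toLp h1 h2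
  refine ⟨(memLp_congr_ae h).2 (Lp.memLp _), ?_⟩
  rw [eLpNorm_congr_ae h, ← ENNReal.toReal_eq_toReal_iff' (Lp.eLpNorm_ne_top _) h2.2.ne,
    ← Lp.norm_def, Lp.norm_fourier_eq, Lp.norm_def, eLpNorm_congr_ae h2.coeFn_toLp]

/-- The kernel e^{-ik·x} and Mathlib's e^{-2πi k·x} differ by the dilation k ↦ k/(2π). -/
theorem spaceFourier_eq {d : ℕ} (f : Space d → ℂ) (k : Space d) :
    spaceFourier f k = 𝓕 f ((2 * Real.pi)⁻¹ • k) := by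
  rw [spaceFourier, Real.fourier_eq']
  refine integral_congr_ae (ae_of_all _ fun x => ?_)
  simp only [smul_eq_mul, real_inner_smul_right, real_inner_comm]
  rw [mul_comm]
  congr 2
  push_cast
  rw [real_inner_comm x k]
  field_simp

/-- The operator norm of `spaceFourier` on `L²` is finite. -/
theorem exists_eLpNorm_spaceFourier_le (d : ℕ) : ∃ K : ℝ≥0∞, K ≠ ⊤ ∧
    ∀ f : Space d → ℂ, Integrable f → MemLp f 2 volume →
      MemLp (spaceFourier f) 2 volume ∧
        eLpNorm (spaceFourier f) 2 volume ≤ K * eLpNorm f 2 volume := by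
  have hr : (2 * Real.pi)⁻¹ ≠ 0 := by positivity
  -- `K₀` is the Jacobian of the dilation by 1/(2π); its square root enters the L² norm.
  set K₀ : ℝ≥0∞ := ENNReal.ofReal |((2 * Real.pi)⁻¹ ^ Module.finrank ℝ (Space d))⁻¹| with hK₀
  have hK₀0 : K₀ ≠ 0 := by rw [hK₀]; simp
  refine ⟨K₀ ^ (1 / (2 : ℝ≥0∞)).toReal, ENNReal.rpow_ne_top_of_nonneg ENNReal.toReal_nonneg ENNReal.ofReal_ne_top,
    fun f h1 h2 => ?_⟩
  have hsf : spaceFourier f = 𝓕 f ∘ fun k => (2 * Real.pi)⁻¹ • k := funext (spaceFourier_eq f)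
  obtain ⟨hm, he⟩ := memLp_fourier h1 h2
  have hmap := Measure.map_addHaar_smul (volume : Measure (Space d)) hr
  have hsm : MemLp (𝓕 f) 2 (Measure.map (fun k => (2 * Real.pi)⁻¹ • k)
      (volume : Measure (Space d))) := by
    rw [hmap]; exact hm.smul_measure ENNReal.ofReal_ne_top
  have hmeas : AEMeasurable (fun k : Space d => (2 * Real.pi)⁻¹ • k) volume := by fun_prop
  rw [hsf]
  refine ⟨(memLp_map_measure_iff hsm.1 hmeas).1 hsm, ?_⟩
  rw [← eLpNorm_map_measure hsm.1 hmeas, hmap, eLpNorm_smul_measure_of_ne_zero hK₀0, he,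
    smul_eq_mul]

/-- A family that is bounded in `L²` and converges almost everywhere converges weakly in `L²`. -/
theorem weak_tendsto_of_ae_tendsto {α ι : Type*} [MeasurableSpace α] {μ : Measure α}
    {l : Filter ι} [l.IsCountablyGenerated] [l.NeBot] {F : ι → α → ℂ} {G : α → ℂ} {B : ℝ≥0∞}
    (hB : B ≠ ⊤) (hF : ∀ᶠ i in l, MemLp (F i) 2 μ) (hFB : ∀ᶠ i in l, eLpNorm (F i) 2 μ ≤ B)
    (hlim : ∀ᵐ x ∂μ, Tendsto (fun i => F i x) l (𝓝 (G x))) :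
    MemLp G 2 μ ∧ ∀ f : α → ℂ, MemLp f 2 μ →
      Tendsto (fun i => ∫ x, F i x * f x ∂μ) l (𝓝 (∫ x, G x * f x ∂μ)) := by
  -- Fatou along a sequence puts the limit in L².
  have main : ∀ u : ℕ → ι, Tendsto u atTop l → MemLp G 2 μ := by
    intro u hu
    obtain ⟨N, hN⟩ := eventually_atTop.1 (hu.eventually (hF.and hFB))
    have hshift : Tendsto (fun n => u (n + N)) atTop l := hu.comp (tendsto_add_atTop_nat N)
    have hmeas : ∀ n, AEStronglyMeasurable (F (u (n + N))) μ :=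
      fun n => (hN _ (Nat.le_add_left _ _)).1.1
    have hl : ∀ᵐ x ∂μ, Tendsto (fun n => F (u (n + N)) x) atTop (𝓝 (G x)) := by
      filter_upwards [hlim] with x hx using hx.comp hshift
    refine ⟨aestronglyMeasurable_of_tendsto_ae atTop hmeas hl,
      ((Lp.eLpNorm_lim_le_liminf_eLpNorm hmeas G hl).trans
        (liminf_le_of_le (by isBoundedDefault) fun b hb => ?_)).trans_lt hB.lt_top⟩
    obtain ⟨n, hn⟩ := hb.exists
    exact hn.trans (hN _ (Nat.le_add_left _ _)).2
  obtain ⟨u, hu⟩ := exists_seq_tendsto l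
  have hG := main u hu
  refine ⟨hG, fun f hf => ?_⟩
  -- the square integrals of the differences are bounded
  set M : ℝ≥0∞ := B + eLpNorm G 2 μ with hM
  have hMtop : M ≠ ⊤ := ENNReal.add_ne_top.2 ⟨hB, hG.2.ne⟩
  have hsq : ∀ᶠ i in l, ∫ x, ‖F i x - G x‖ ^ 2 ∂μ ≤ M.toReal ^ 2 := by
    filter_upwards [hF, hFB] with i hi hiB
    have hd : MemLp (F i - G) 2 μ := hi.sub hG
    have h1 : eLpNorm (F i - G) 2 μ ≤ M :=
      (eLpNorm_sub_le hi.1 hG.1 (by norm_num)).trans (add_le_add_left hiB _)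
    have h2 : (eLpNorm (F i - G) 2 μ).toReal ^ 2 = ∫ x, ‖F i x - G x‖ ^ 2 ∂μ := by
      rw [hd.eLpNorm_eq_integral_rpow_norm (by norm_num) (by norm_num)]
      have h0 : 0 ≤ ∫ x, ‖F i x - G x‖ ^ 2 ∂μ := integral_nonneg fun x => by positivity
      simp only [ENNReal.toReal_ofNat, Real.rpow_ofNat, Pi.sub_apply]
      rw [ENNReal.toReal_ofReal (by positivity), ← Real.rpow_natCast, ← Real.rpow_mul h0]
      norm_num
    rw [← h2]
    exact pow_le_pow_left₀ ENNReal.toReal_nonneg (ENNReal.toReal_mono hMtop h1) 2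
  rw [tendsto_iff_norm_sub_tendsto_zero]
  refine Metric.tendsto_nhds.2 fun δ hδ => ?_
  -- With a = ‖F i - G‖ and b = ‖f‖, the splitting used is ab ≤ a²/R + min(ab, R b²): if ab > R b²
  -- then b < a/R. The first term is uniformly small for large R; the second is dominated by R b²
  -- and tends to 0 pointwise.
  obtain ⟨R, hR0, hR⟩ : ∃ R : ℝ, 0 < R ∧ M.toReal ^ 2 / R < δ / 2 := by
    refine ⟨2 * (M.toReal ^ 2 + 1) / δ, by positivity, ?_⟩
    rw [div_div_eq_mul_div, div_lt_iff₀ (by positivity)]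
    nlinarith
  have hf2 : Integrable (fun x => ‖f x‖ ^ 2) μ := hf.integrable_norm_pow (by norm_num)
  have hdct : Tendsto (fun i => ∫ x, min (‖F i x - G x‖ * ‖f x‖) (R * ‖f x‖ ^ 2) ∂μ) l
      (𝓝 (∫ x, (0 : ℝ) ∂μ)) := by
    refine tendsto_integral_filter_of_dominated_convergence (fun x => R * ‖f x‖ ^ 2) ?_ ?_
      (hf2.const_mul R) ?_
    · filter_upwards [hF] with i hi
      exact (((hi.1.sub hG.1).norm.mul hf.1.norm).inf (hf2.1.const_mul R))
    · refine Eventually.of_forall fun i => ae_of_all _ fun x => ?_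
      rw [Real.norm_of_nonneg (by positivity)]
      exact min_le_right _ _
    · filter_upwards [hlim] with x hx
      have h1 : Tendsto (fun i => ‖F i x - G x‖ * ‖f x‖) l (𝓝 0) := by
        simpa using (tendsto_iff_norm_sub_tendsto_zero.1 hx).mul_const ‖f x‖
      refine squeeze_zero (fun i => by positivity) (fun i => min_le_left _ _) h1
  rw [integral_zero] at hdct
  filter_upwards [hF, hsq, hdct.eventually (gt_mem_nhds (half_pos hδ))] with i hi hisq hidct
  have hd : MemLp (fun x => F i x - G x) 2 μ := hi.sub hG
  have hd2 : Integrable (fun x => ‖F i x - G x‖ ^ 2) μ := hd.integrable_norm_pow (by norm_num)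
  have hmin : Integrable (fun x => min (‖F i x - G x‖ * ‖f x‖) (R * ‖f x‖ ^ 2)) μ := by
    refine (hf2.const_mul R).mono' (((hi.1.sub hG.1).norm.mul hf.1.norm).inf
      (hf2.1.const_mul R)) (ae_of_all _ fun x => ?_)
    rw [Real.norm_of_nonneg (by positivity)]
    exact min_le_right _ _
  rw [dist_zero_right, norm_norm, ← integral_sub (f := fun x => F i x * f x) (g := fun x => G x * f x)
    (hi.integrable_mul hf) (hG.integrable_mul hf)]
  calc ‖∫ x, (F i x * f x - G x * f x) ∂μ‖
      ≤ ∫ x, (‖F i x - G x‖ ^ 2 / R + min (‖F i x - G x‖ * ‖f x‖) (R * ‖f x‖ ^ 2)) ∂μ := by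
        refine norm_integral_le_of_norm_le ((hd2.div_const R).add hmin) (ae_of_all _ fun x => ?_)
        rw [← sub_mul, norm_mul]
        set a := ‖F i x - G x‖
        set b := ‖f x‖
        have ha : 0 ≤ a := norm_nonneg _
        have hb : 0 ≤ b := norm_nonneg _
        rcases le_total (a * b) (R * b ^ 2) with h | h
        · rw [min_eq_left h]; linarith [div_nonneg (sq_nonneg a) hR0.le]
        · rcases hb.eq_or_lt with h0 | h0
          · rw [← h0]; simp; positivity
          · have hab : R * b ≤ a := by nlinarith
            have : a * b ≤ a ^ 2 / R := by
              rw [le_div_iff₀ hR0]; nlinarith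
            have h4 : 0 ≤ min (a * b) (R * b ^ 2) := by positivity
            linarith
    _ = (∫ x, ‖F i x - G x‖ ^ 2 ∂μ) / R +
          ∫ x, min (‖F i x - G x‖ * ‖f x‖) (R * ‖f x‖ ^ 2) ∂μ := by
        rw [integral_add (hd2.div_const R) hmin, integral_div]
    _ < δ := by
        have : (∫ x, ‖F i x - G x‖ ^ 2 ∂μ) / R ≤ M.toReal ^ 2 / R := by gcongr
        linarith

end L2

/-! ### Polar coordinates centred on the shell. -/

/-- The direction of `x`, with the value `q₀` at `x = 0`. -/
def dirOf {d : ℕ} (q₀ : Sphere d) (x : Space d) : Sphere d :=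
  open scoped Classical in if hx : x ≠ 0 then direction x hx else q₀

theorem dirOf_of_ne {d : ℕ} (q₀ : Sphere d) {x : Space d} (hx : x ≠ 0) :
    dirOf q₀ x = direction x hx := by simp [dirOf, hx]

theorem dirOf_smul {d : ℕ} (q₀ q : Sphere d) {r : ℝ} (hr : 0 < r) :
    dirOf q₀ (r • (q : Space d)) = q := by
  have hq : ‖(q : Space d)‖ = 1 := norm_eq_of_mem_sphere q
  have hq0 : (q : Space d) ≠ 0 := by rw [← norm_ne_zero_iff, hq]; norm_num
  have h0 : r • (q : Space d) ≠ 0 := smul_ne_zero hr.ne' hq0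
  rw [dirOf_of_ne q₀ h0]
  ext1
  simp [direction, norm_smul, hq, abs_of_pos hr, smul_smul, hr.ne']

theorem norm_smul_direction {d : ℕ} {x : Space d} (hx : x ≠ 0) :
    ‖x‖ • (direction x hx : Space d) = x := by
  simp [direction, smul_smul, hx]

theorem measurable_dirOf {d : ℕ} (q₀ : Sphere d) : Measurable (dirOf q₀) := by
  refine measurable_of_measurable_on_compl_singleton 0 ?_
  have h : domRestrict {x : Space d | x ≠ 0} (dirOf q₀) = fun x => direction x.1 x.2 :=
    funext fun x => dirOf_of_ne q₀ x.2
  rw [h]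
  exact Measurable.subtype_mk (by fun_prop)

/-- Image of the Lebesgue measure under `x ↦ (|x| - T, x / |x|)`. -/
def shellMeasure (d : ℕ) (T : ℝ) : Measure (ℝ × Sphere d) :=
  ((volume.restrict (Ioi (-T))).withDensity
    fun z => ENNReal.ofReal ((z + T) ^ (d - 1))).prod (surfaceMeasure d)

instance (d : ℕ) : IsFiniteMeasure (surfaceMeasure d) := by
  unfold surfaceMeasure; infer_instance

theorem map_volumeIoiPow (n : ℕ) (T : ℝ) :
    (Measure.volumeIoiPow n).map (fun r : Ioi (0 : ℝ) => (r : ℝ) - T) =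
      (volume.restrict (Ioi (-T))).withDensity fun z => ENNReal.ofReal ((z + T) ^ n) := by
  refine Measure.ext_of_lintegral _ fun f hf => ?_
  rw [lintegral_map hf (by fun_prop), Measure.volumeIoiPow,
    lintegral_withDensity_eq_lintegral_mul _ (by fun_prop) (by fun_prop),
    lintegral_withDensity_eq_lintegral_mul _ (by fun_prop) (by fun_prop)]
  simp only [Pi.mul_apply]
  rw [lintegral_subtype_comap measurableSet_Ioi
      (fun r : ℝ => ENNReal.ofReal (r ^ n) * f (r - T)),
    ← lintegral_indicator measurableSet_Ioi, ← lintegral_indicator measurableSet_Ioi,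
    ← lintegral_sub_right_eq_self ((Ioi (-T)).indicator _) T]
  refine lintegral_congr fun r => ?_
  simp [indicator]

/-- Polar decomposition on the complement of the origin, followed by the translation r ↦ r - T. The
removed point is null, so the choice of `q₀` is irrelevant. -/
theorem measurePreserving_shellCoord {d : ℕ} [NeZero d] (q₀ : Sphere d) (T : ℝ) :
    MeasurePreserving (fun x : Space d => (‖x‖ - T, dirOf q₀ x)) volume (shellMeasure d T) := by
  have hm : Measurable (fun x : Space d => (‖x‖ - T, dirOf q₀ x)) :=
    (measurable_norm.sub_const T).prodMk (measurable_dirOf q₀)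
  refine ⟨hm, ?_⟩
  have hval : Measure.map (Subtype.val : ({0}ᶜ : Set (Space d)) → Space d)
      (Measure.comap Subtype.val volume) = volume := by
    rw [map_comap_subtype_coe (measurableSet_singleton _).compl, restrict_compl_singleton]
  have hpolar := (volume : Measure (Space d)).measurePreserving_homeomorphUnitSphereProd
  have hfun : (fun x : Space d => (‖x‖ - T, dirOf q₀ x)) ∘ Subtype.val =
      (Prod.map (fun r : Ioi (0 : ℝ) => (r : ℝ) - T) id ∘ Prod.swap) ∘
        homeomorphUnitSphereProd (Space d) := by
    funext x
    have hx : (x : Space d) ≠ 0 := x.2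
    simp only [Function.comp_apply, dirOf_of_ne q₀ hx, Prod.swap]
    ext
    · simp
    · simp [direction]
  have hg : Measurable (Prod.map (fun r : Ioi (0 : ℝ) => (r : ℝ) - T) (id : Sphere d → Sphere d)) :=
    by fun_prop
  conv_lhs => rw [← hval]
  rw [Measure.map_map hm measurable_subtype_coe, hfun,
    ← Measure.map_map (hg.comp measurable_swap) hpolar.measurable, hpolar.map_eq,
    ← Measure.map_map hg measurable_swap, Measure.prod_swap,
    ← Measure.map_prod_map _ _ (by fun_prop) measurable_id, map_volumeIoiPow, Measure.map_id]
  simp [shellMeasure, surfaceMeasure]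

/-! ### The surface measure in explicit coordinates. -/

/-- The radial mass `∫₀¹ r^n dr`. -/
def radialMass (n : ℕ) : ENNReal :=
  ∫⁻ r : ℝ in Ioi 0, (Iio (1 : ℝ)).indicator (fun r => ENNReal.ofReal (r ^ n)) r

theorem radialMass_eq (n : ℕ) : radialMass n = ENNReal.ofReal (1 / (n + 1)) := by
  rw [radialMass, lintegral_indicator measurableSet_Iio, Measure.restrict_restrict measurableSet_Iio,
    Iio_inter_Ioi, Measure.restrict_congr_set Ioo_ae_eq_Ioc,
    ← ofReal_integral_eq_lintegral_ofReal (intervalIntegral.intervalIntegrable_pow _).1,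
    ← intervalIntegral.integral_of_le zero_le_one]
  · simp
  · filter_upwards [ae_restrict_mem measurableSet_Ioc] with y hy
    exact pow_nonneg hy.1.le _

theorem radialMass_ne_zero (n : ℕ) : radialMass n ≠ 0 := by
  rw [radialMass_eq]
  simp only [ne_eq, ENNReal.ofReal_eq_zero, not_le]
  positivity

theorem radialMass_ne_top (n : ℕ) : radialMass n ≠ ⊤ := by
  rw [radialMass_eq]; exact ENNReal.ofReal_ne_top

/-- The case T = 0 of the shell coordinates. As the radial mass is nonzero and finite it can be
cancelled, so any coordinate formula for Lebesgue measure on the unit ball determines the surface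
measure. -/
theorem lintegral_ball_dirOf {d : ℕ} [NeZero d] (q₀ : Sphere d) {f : Sphere d → ENNReal}
    (hf : Measurable f) :
    ∫⁻ x : Space d, (Metric.ball 0 1).indicator (fun x => f (dirOf q₀ x)) x =
      radialMass (d - 1) * ∫⁻ q, f q ∂surfaceMeasure d := by
  have h := (measurePreserving_shellCoord q₀ 0).lintegral_comp
    (f := fun p => (Iio (1 : ℝ)).indicator 1 p.1 * f p.2)
    (((measurable_one.indicator measurableSet_Iio).comp measurable_fst).mul
      (hf.comp measurable_snd))
  rw [shellMeasure, lintegral_prod_mul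
    (f := (Iio (1 : ℝ)).indicator 1) (measurable_one.indicator measurableSet_Iio).aemeasurable
    hf.aemeasurable,
    lintegral_withDensity_eq_lintegral_mul _ (by fun_prop)
      (measurable_one.indicator measurableSet_Iio)] at h
  convert h using 2
  · funext x
    by_cases hx : ‖x‖ < 1 <;> simp [indicator, hx]
  · rw [radialMass]
    simp [indicator]

/-- The point of the circle with angle `θ` in the frame `b`. -/
def circlePoint (b : OrthonormalBasis (Fin 2) ℝ (Space 2)) (θ : ℝ) : Sphere 2 :=
  ⟨b.repr.symm !₂[Real.cos θ, Real.sin θ], by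
    simp [EuclideanSpace.norm_eq, Fin.sum_univ_two]⟩

/-- The point of the sphere with colatitude `φ` and longitude `θ` in the frame `b`. -/
def spherePoint (b : OrthonormalBasis (Fin 3) ℝ (Space 3)) (φ θ : ℝ) : Sphere 3 :=
  ⟨b.repr.symm !₂[Real.cos φ, Real.sin φ * Real.cos θ, Real.sin φ * Real.sin θ], by
    have h : Real.cos φ ^ 2 + (Real.sin φ * Real.cos θ) ^ 2 + (Real.sin φ * Real.sin θ) ^ 2 = 1 := by
      have h1 := Real.sin_sq_add_cos_sq φ
      have h2 := Real.sin_sq_add_cos_sq θ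
      linear_combination (Real.sin φ) ^ 2 * h2 + h1
    simp [EuclideanSpace.norm_eq, Fin.sum_univ_three, h]⟩

theorem measurePreserving_pairFrame (b : OrthonormalBasis (Fin 2) ℝ (Space 2)) :
    MeasurePreserving (fun p : ℝ × ℝ => b.repr.symm !₂[p.1, p.2]) volume volume :=
  b.measurePreserving_repr_symm.comp
    (((EuclideanSpace.volume_preserving_symm_measurableEquiv_toLp (Fin 2)).symm).comp
      ((volume_preserving_piFinTwo fun _ => ℝ).symm))

theorem measurePreserving_tripleFrame (b : OrthonormalBasis (Fin 3) ℝ (Space 3)) :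
    MeasurePreserving (fun p : ℝ × ℝ × ℝ => b.repr.symm !₂[p.1, p.2.1, p.2.2]) volume volume := by
  have h1 : MeasurePreserving (Prod.map id (MeasurableEquiv.piFinTwo fun _ => ℝ).symm)
      (volume : Measure (ℝ × ℝ × ℝ)) volume :=
    (MeasurePreserving.id volume).prod ((volume_preserving_piFinTwo fun _ => ℝ).symm)
  have h2 := (volume_preserving_piFinSuccAbove (fun _ : Fin 3 => ℝ) 0).symm
  have h3 := b.measurePreserving_repr_symm.comp
    (((EuclideanSpace.volume_preserving_symm_measurableEquiv_toLp (Fin 3)).symm).comp (h2.comp h1))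
  convert h3 using 1
  funext p
  simp only [Function.comp_apply]
  congr 1
  ext i
  fin_cases i <;> rfl

theorem measurePreserving_lineFrame (b : OrthonormalBasis (Fin 1) ℝ (Space 1)) :
    MeasurePreserving (fun t : ℝ => b.repr.symm !₂[t]) volume volume := by
  have h3 := b.measurePreserving_repr_symm.comp
    (((EuclideanSpace.volume_preserving_symm_measurableEquiv_toLp (Fin 1)).symm).comp
      (volume_preserving_funUnique (Fin 1) ℝ).symm)
  convert h3 using 1
  funext t
  simp only [Function.comp_apply]
  congr 1
  ext i
  fin_cases i; rfl

theorem measurable_circlePoint (b : OrthonormalBasis (Fin 2) ℝ (Space 2)) :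
    Measurable (circlePoint b) := by
  refine Measurable.subtype_mk (Continuous.measurable ?_)
  fun_prop

theorem measurable_spherePoint (b : OrthonormalBasis (Fin 3) ℝ (Space 3)) :
    Measurable (fun p : ℝ × ℝ => spherePoint b p.1 p.2) := by
  refine Measurable.subtype_mk (Continuous.measurable ?_)
  fun_prop

theorem measurable_spherePoint_right (b : OrthonormalBasis (Fin 3) ℝ (Space 3)) (φ : ℝ) :
    Measurable (spherePoint b φ) := by
  refine Measurable.subtype_mk (Continuous.measurable ?_)
  fun_prop

theorem smul_circlePoint (b : OrthonormalBasis (Fin 2) ℝ (Space 2)) (r θ : ℝ) :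
    b.repr.symm !₂[r * Real.cos θ, r * Real.sin θ] = r • (circlePoint b θ : Space 2) := by
  rw [circlePoint, ← map_smul]
  congr 1
  ext i
  fin_cases i <;> simp

theorem smul_spherePoint (b : OrthonormalBasis (Fin 3) ℝ (Space 3)) (r φ θ : ℝ) :
    b.repr.symm !₂[r * Real.cos φ, r * Real.sin φ * Real.cos θ, r * Real.sin φ * Real.sin θ] =
      r • (spherePoint b φ θ : Space 3) := by
  rw [spherePoint, ← map_smul]
  congr 1
  ext i
  fin_cases i <;> simp [mul_assoc]

/-- The value of a function of the direction, cut off to the unit ball, in polar form. -/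
theorem indicator_ball_smul {d : ℕ} (q₀ q : Sphere d) (f : Sphere d → ENNReal) {r : ℝ}
    (hr : 0 < r) :
    (Metric.ball (0 : Space d) 1).indicator (fun x => f (dirOf q₀ x)) (r • (q : Space d)) =
      (Iio (1 : ℝ)).indicator 1 r * f q := by
  have hq : ‖r • (q : Space d)‖ = r := by
    rw [norm_smul, norm_eq_of_mem_sphere q, Real.norm_of_nonneg hr.le, mul_one]
  by_cases h : r < 1 <;> simp [indicator, hq, h, dirOf_smul q₀ q hr]

theorem measurable_ball_dirOf {d : ℕ} (q₀ : Sphere d) {f : Sphere d → ENNReal}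
    (hf : Measurable f) :
    Measurable ((Metric.ball (0 : Space d) 1).indicator (fun x => f (dirOf q₀ x))) :=
  (hf.comp (measurable_dirOf q₀)).indicator measurableSet_ball

theorem radialMass_eq' (n : ℕ) :
    radialMass n = ∫⁻ r : ℝ in Ioi 0, ENNReal.ofReal (r ^ n) * (Iio (1 : ℝ)).indicator 1 r := by
  rw [radialMass]
  simp [indicator]

/-- Planar polar coordinates on the unit disc, with the radial factor cancelled. -/
theorem measurePreserving_circlePoint (b : OrthonormalBasis (Fin 2) ℝ (Space 2)) :
    MeasurePreserving (circlePoint b) (volume.restrict (Ioo (-Real.pi) Real.pi))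
      (surfaceMeasure 2) := by
  refine ⟨measurable_circlePoint b, Measure.ext_of_lintegral _ fun f hf => ?_⟩
  rw [lintegral_map hf (measurable_circlePoint b)]
  refine (ENNReal.mul_right_inj (radialMass_ne_zero 1) (radialMass_ne_top 1)).1 ?_
  have h := lintegral_ball_dirOf (circlePoint b 0) hf
  rw [← (measurePreserving_pairFrame b).lintegral_comp (measurable_ball_dirOf _ hf),
    ← lintegral_comp_polarCoord_symm] at h
  rw [show (2 - 1 : ℕ) = 1 from rfl] at h
  have hprod := lintegral_prod_mul (μ := volume.restrict (Ioi (0 : ℝ)))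
    (ν := volume.restrict (Ioo (-Real.pi) Real.pi))
    (f := fun r : ℝ => ENNReal.ofReal (r ^ 1) * (Iio (1 : ℝ)).indicator 1 r)
    (g := fun θ => f (circlePoint b θ))
    (Measurable.mul (by fun_prop) (measurable_one.indicator measurableSet_Iio)).aemeasurable
    (hf.comp (measurable_circlePoint b)).aemeasurable
  rw [← h, polarCoord_target, radialMass_eq', ← hprod, Measure.prod_restrict,
    ← Measure.volume_eq_prod]
  refine setLIntegral_congr_fun (measurableSet_Ioi.prod measurableSet_Ioo) fun p hp => ?_
  have hp1 : 0 < p.1 := hp.1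
  simp only [polarCoord_symm_apply, smul_circlePoint, indicator_ball_smul _ _ f hp1]
  simp [mul_assoc]

/-- The measure `sin φ dφ dθ` on `(0, π) × (-π, π)`. -/
def angularMeasure : Measure (ℝ × ℝ) :=
  ((volume.restrict (Ioo 0 Real.pi)).withDensity fun φ => ENNReal.ofReal (Real.sin φ)).prod
    (volume.restrict (Ioo (-Real.pi) Real.pi))

/-- Integration in cylindrical coordinates. -/
theorem lintegral_cylindrical {H : ℝ × ℝ × ℝ → ENNReal} (hH : Measurable H) :
    ∫⁻ p, H p = ∫⁻ y : ℝ × ℝ, (Ioi (0 : ℝ)).indicator ENNReal.ofReal y.2 *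
      ∫⁻ θ in Ioo (-Real.pi) Real.pi, H (y.1, y.2 * Real.cos θ, y.2 * Real.sin θ) := by
  have hm : Measurable (fun p : (ℝ × ℝ) × ℝ =>
      H (p.1.1, p.1.2 * Real.cos p.2, p.1.2 * Real.sin p.2)) := hH.comp (by fun_prop)
  have hJ : Measurable (fun y : ℝ × ℝ => ∫⁻ θ in Ioo (-Real.pi) Real.pi,
      H (y.1, y.2 * Real.cos θ, y.2 * Real.sin θ)) := hm.lintegral_prod_right'
  have hind : Measurable (fun y : ℝ × ℝ => (Ioi (0 : ℝ)).indicator ENNReal.ofReal y.2) :=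
    (ENNReal.measurable_ofReal.indicator measurableSet_Ioi).comp measurable_snd
  rw [Measure.volume_eq_prod, lintegral_prod _ hH.aemeasurable, Measure.volume_eq_prod,
    lintegral_prod _ (by exact (hind.mul hJ).aemeasurable)]
  refine lintegral_congr fun a => ?_
  rw [← Measure.volume_eq_prod, ← lintegral_comp_polarCoord_symm, polarCoord_target,
    Measure.volume_eq_prod, ← Measure.prod_restrict, lintegral_prod, ← lintegral_indicator
    measurableSet_Ioi]
  · refine lintegral_congr fun ρ => ?_
    by_cases hρ : 0 < ρ
    · simp only [indicator_of_mem (mem_Ioi.2 hρ), smul_eq_mul, polarCoord_symm_apply]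
      rw [lintegral_const_mul]
      exact hH.comp (by fun_prop)
    · simp [indicator, hρ]
  · refine (Measurable.mul (by fun_prop) (hH.comp ?_)).aemeasurable
    exact measurable_const.prodMk (continuous_polarCoord_symm.measurable)

/-- Polar coordinates are used twice: in the plane orthogonal to the axis, then in the (axis,
distance to axis) plane. The Jacobians multiply to r · r sin φ = r² sin φ, and the radial part
cancels. -/
theorem measurePreserving_spherePoint (b : OrthonormalBasis (Fin 3) ℝ (Space 3)) :
    MeasurePreserving (fun p : ℝ × ℝ => spherePoint b p.1 p.2) angularMeasure
      (surfaceMeasure 3) := by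
  have hsp := measurable_spherePoint b
  refine ⟨hsp, Measure.ext_of_lintegral _ fun f hf => ?_⟩
  rw [lintegral_map hf hsp]
  refine (ENNReal.mul_right_inj (radialMass_ne_zero 2) (radialMass_ne_top 2)).1 ?_
  have hfs : Measurable (fun p : ℝ × ℝ => f (spherePoint b p.1 p.2)) := hf.comp hsp
  have h := lintegral_ball_dirOf (spherePoint b 0 0) hf
  have hH := (measurable_ball_dirOf (spherePoint b 0 0) hf).comp
    (measurePreserving_tripleFrame b).measurable
  have hJ : Measurable (fun φ : ℝ => ∫⁻ θ in Ioo (-Real.pi) Real.pi, f (spherePoint b φ θ)) :=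
    hfs.lintegral_prod_right'
  have hsin : Measurable (fun φ : ℝ => ENNReal.ofReal (Real.sin φ)) := by fun_prop
  rw [← (measurePreserving_tripleFrame b).lintegral_comp (measurable_ball_dirOf _ hf),
    lintegral_cylindrical (by exact hH), ← lintegral_comp_polarCoord_symm] at h
  rw [show (3 - 1 : ℕ) = 2 from rfl] at h
  have hprod := lintegral_prod_mul (μ := volume.restrict (Ioi (0 : ℝ)))
    (ν := volume.restrict (Ioo (-Real.pi) Real.pi))
    (f := fun r : ℝ => ENNReal.ofReal (r ^ 2) * (Iio (1 : ℝ)).indicator 1 r)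
    (g := (Ioi (0 : ℝ)).indicator fun φ => ENNReal.ofReal (Real.sin φ) *
      ∫⁻ θ in Ioo (-Real.pi) Real.pi, f (spherePoint b φ θ))
    (Measurable.mul (by fun_prop) (measurable_one.indicator measurableSet_Iio)).aemeasurable
    ((hsin.mul hJ).indicator measurableSet_Ioi).aemeasurable
  -- The second polar angle runs over (-π, π); positivity of the distance to the axis, r sin φ, cuts
  -- it down to (0, π).
  have hpi : Ioi (0 : ℝ) ∩ Ioo (-Real.pi) Real.pi = Ioo 0 Real.pi := by
    ext φ
    simp only [mem_inter_iff, mem_Ioi, mem_Ioo]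
    constructor
    · rintro ⟨h1, -, h2⟩; exact ⟨h1, h2⟩
    · rintro ⟨h1, h2⟩; exact ⟨h1, by linarith, h2⟩
  rw [lintegral_indicator measurableSet_Ioi, Measure.restrict_restrict measurableSet_Ioi,
    hpi] at hprod
  rw [angularMeasure, lintegral_prod _ hfs.aemeasurable,
    lintegral_withDensity_eq_lintegral_mul _ hsin hJ]
  simp only [Pi.mul_apply]
  rw [radialMass_eq', ← hprod, ← radialMass_eq', ← h, polarCoord_target, Measure.prod_restrict,
    ← Measure.volume_eq_prod]
  refine setLIntegral_congr_fun (measurableSet_Ioi.prod measurableSet_Ioo) fun p hp => ?_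
  have hp1 : 0 < p.1 := hp.1
  simp only [polarCoord_symm_apply, smul_spherePoint, indicator_ball_smul _ _ f hp1]
  have hθ : Measurable (fun θ => f (spherePoint b p.2 θ)) :=
    hf.comp (measurable_spherePoint_right b p.2)
  rw [lintegral_const_mul _ hθ]
  simp only [indicator_apply (Ioi (0 : ℝ))]
  generalize ∫⁻ θ in Ioo (-Real.pi) Real.pi, f (spherePoint b p.2 θ) = J
  generalize (Iio (1 : ℝ)).indicator (1 : ℝ → ENNReal) p.1 = χ
  by_cases hφ : 0 < p.2
  · have hs : 0 < Real.sin p.2 := Real.sin_pos_of_pos_of_lt_pi hφ hp.2.2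
    rw [if_pos (mem_Ioi.2 hφ), if_pos (mem_Ioi.2 (mul_pos hp1 hs)),
      ENNReal.ofReal_mul hp1.le, ENNReal.ofReal_pow hp1.le, smul_eq_mul]
    ring
  · have hs : Real.sin p.2 ≤ 0 :=
      Real.sin_nonpos_of_nonpos_of_neg_pi_le (not_lt.1 hφ) hp.2.1.le
    rw [if_neg (by simpa using hφ), if_neg
      (by simpa using mul_nonpos_of_nonneg_of_nonpos hp1.le hs)]
    simp

/-- In dimension one the surface measure is the counting measure on two points. -/
theorem surfaceMeasure_one (q : Sphere 1) :
    surfaceMeasure 1 = Measure.dirac q + Measure.dirac (-q) := by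
  refine Measure.ext_of_lintegral _ fun f hf => ?_
  have hq : ‖(q : Space 1)‖ = 1 := norm_eq_of_mem_sphere q
  obtain ⟨b, hb⟩ := Orthonormal.exists_orthonormalBasis_extension_of_card_eq (ι := Fin 1)
    (𝕜 := ℝ) (E := Space 1) (by simp) (v := fun _ => (q : Space 1)) (s := univ)
    ⟨fun _ => hq, fun i j hij => absurd (Subsingleton.elim i j) hij⟩
  have hline : ∀ t : ℝ, b.repr.symm (WithLp.toLp 2 ![t]) = t • (q : Space 1) := fun t => by
    rw [← b.sum_repr_symm]; simp [hb]
  have h := lintegral_ball_dirOf q hf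
  rw [← (measurePreserving_lineFrame b).lintegral_comp (measurable_ball_dirOf _ hf)] at h
  simp only [hline] at h
  have hc : radialMass (1 - 1) = 1 := by rw [radialMass_eq]; simp
  rw [hc, one_mul] at h
  rw [← h, lintegral_add_measure, lintegral_dirac' _ hf, lintegral_dirac' _ hf,
    ← lintegral_add_compl _ (measurableSet_Ioi (a := (0 : ℝ))), compl_Ioi,
    Measure.restrict_congr_set Iio_ae_eq_Iic.symm]
  -- Each half-line meets the unit ball in length 1, which gives both atoms mass 1.
  have hmass : ∫⁻ t : ℝ in Ioi 0, (Iio (1 : ℝ)).indicator 1 t = 1 := by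
    rw [← hc, radialMass_eq']; simp
  congr 1
  · rw [setLIntegral_congr_fun measurableSet_Ioi
      (fun t ht => indicator_ball_smul q q f (mem_Ioi.1 ht)), lintegral_mul_const _
      (measurable_one.indicator measurableSet_Iio), hmass, one_mul]
  · have hneg : ∫⁻ t in Iio (0 : ℝ), (Metric.ball (0 : Space 1) 1).indicator
        (fun x => f (dirOf q x)) (t • (q : Space 1)) =
        ∫⁻ t in Ioi (0 : ℝ), (Metric.ball (0 : Space 1) 1).indicator
        (fun x => f (dirOf q x)) (t • ((-q : Sphere 1) : Space 1)) := by
      rw [← lintegral_indicator measurableSet_Iio, ← lintegral_indicator measurableSet_Ioi,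
        ← lintegral_neg_eq_self]
      refine lintegral_congr fun t => ?_
      simp [indicator]
    rw [hneg, setLIntegral_congr_fun measurableSet_Ioi
      (fun t ht => indicator_ball_smul q (-q) f (mem_Ioi.1 ht)), lintegral_mul_const _
      (measurable_one.indicator measurableSet_Iio), hmass, one_mul]

/-! ### Fresnel integral, stationary phase and Riemann–Lebesgue in one variable. -/

/-- The incomplete Fresnel integral `∫₀ˣ e^{is²/2} ds`. -/
def fresnel (x : ℝ) : ℂ := ∫ s in (0 : ℝ)..x, Complex.exp (Complex.I * (s : ℂ) ^ 2 / 2)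

theorem hasDerivAt_fresnel (x : ℝ) :
    HasDerivAt fresnel (Complex.exp (Complex.I * (x : ℂ) ^ 2 / 2)) x := by
  have hc : Continuous fun s : ℝ => Complex.exp (Complex.I * (s : ℂ) ^ 2 / 2) := by fun_prop
  exact intervalIntegral.integral_hasDerivAt_right (hc.intervalIntegrable _ _)
    (hc.stronglyMeasurableAtFilter _ _) hc.continuousAt

theorem continuous_fresnel : Continuous fresnel :=
  continuous_iff_continuousAt.2 fun x => (hasDerivAt_fresnel x).continuousAt

theorem fresnel_zero : fresnel 0 = 0 := by simp [fresnel]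

theorem norm_exp_I_sq (s : ℝ) : ‖Complex.exp (Complex.I * (s : ℂ) ^ 2 / 2)‖ = 1 := by
  rw [show Complex.I * (s : ℂ) ^ 2 / 2 = ((s ^ 2 / 2 : ℝ) : ℂ) * Complex.I by push_cast; ring]
  exact Complex.norm_exp_ofReal_mul_I _

/-- With E(s) = e^{is²/2}, the derivative of E/(is) is E - E/(is²). The boundary term decays like
1/x, and E/(is²) is absolutely integrable on (1, ∞). -/
theorem exists_tendsto_fresnel : ∃ L : ℂ, Tendsto fresnel atTop (𝓝 L) := by
  set E : ℝ → ℂ := fun s => Complex.exp (Complex.I * (s : ℂ) ^ 2 / 2) with hE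
  have hEc : Continuous E := by fun_prop
  have hint : IntegrableOn (fun s : ℝ => E s / (Complex.I * (s : ℂ) ^ 2)) (Ioi 1) := by
    have h := integrableOn_Ioi_rpow_of_lt (a := -2) (by norm_num) (c := 1) one_pos
    refine h.mono' ?_ ?_
    · exact (Measurable.aestronglyMeasurable (by fun_prop))
    · filter_upwards [ae_restrict_mem measurableSet_Ioi] with s hs
      have hs0 : (0 : ℝ) < s := lt_trans one_pos hs
      rw [norm_div, hE, norm_exp_I_sq, norm_mul, Complex.norm_I, norm_pow, Complex.norm_real,
        Real.norm_of_nonneg hs0.le, Real.rpow_neg hs0.le]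
      simp
  have hu : Tendsto (fun x : ℝ => E x / (Complex.I * x)) atTop (𝓝 0) := by
    rw [tendsto_zero_iff_norm_tendsto_zero]
    have : (fun x : ℝ => ‖E x / (Complex.I * x)‖) = fun x => |x|⁻¹ := by
      funext x
      rw [norm_div, hE, norm_exp_I_sq]
      simp
    rw [this]
    exact tendsto_inv_atTop_zero.comp tendsto_abs_atTop_atTop
  have hlim := (hu.sub_const (E 1 / (Complex.I * (1 : ℝ)))).add
    (intervalIntegral_tendsto_integral_Ioi 1 hint tendsto_id)
  refine ⟨_, (hlim.const_add (fresnel 1)).congr' ?_⟩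
  filter_upwards [eventually_ge_atTop 1] with x hx
  have hder : ∀ s ∈ uIcc 1 x, HasDerivAt (fun s : ℝ => E s / (Complex.I * s))
      (E s - E s / (Complex.I * (s : ℂ) ^ 2)) s := by
    intro s hs
    rw [uIcc_of_le hx] at hs
    have hs0 : (s : ℂ) ≠ 0 := by exact_mod_cast (lt_of_lt_of_le one_pos hs.1).ne'
    have h1 : HasDerivAt E (E s * (Complex.I * s)) s := by
      have h0 : HasDerivAt (fun s : ℝ => Complex.I * (s : ℂ) ^ 2 / 2)
          (Complex.I * s) s := by
        have := ((((hasDerivAt_id (s : ℂ)).pow 2).const_mul Complex.I).div_const 2).comp_ofReal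
        refine this.congr_deriv ?_
        simp; ring
      exact h0.cexp
    have h2 : HasDerivAt (fun s : ℝ => Complex.I * (s : ℂ)) Complex.I s := by
      simpa using ((hasDerivAt_id (s : ℂ)).const_mul Complex.I).comp_ofReal
    refine (h1.div h2 (mul_ne_zero Complex.I_ne_zero hs0)).congr_deriv ?_
    have hI := Complex.I_ne_zero
    field_simp
  have hci : ContinuousOn (fun s : ℝ => E s / (Complex.I * (s : ℂ) ^ 2)) (uIcc 1 x) := by
    refine hEc.continuousOn.div (by fun_prop) fun s hs => ?_
    rw [uIcc_of_le hx] at hs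
    have hs0 : (s : ℂ) ≠ 0 := by exact_mod_cast (lt_of_lt_of_le one_pos hs.1).ne'
    exact mul_ne_zero Complex.I_ne_zero (pow_ne_zero _ hs0)
  have hftc := intervalIntegral.integral_eq_sub_of_hasDerivAt hder
    ((hEc.continuousOn.sub hci).intervalIntegrable)
  rw [intervalIntegral.integral_sub (hEc.intervalIntegrable _ _) hci.intervalIntegrable] at hftc
  have hadd : fresnel 1 + ∫ s in (1 : ℝ)..x, E s = fresnel x :=
    intervalIntegral.integral_add_adjacent_intervals (hEc.intervalIntegrable _ _)
      (hEc.intervalIntegrable _ _)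
  rw [← hadd]
  simp only [id]
  linear_combination -hftc

theorem exists_norm_fresnel_le : ∃ B : ℝ, ∀ x, 0 ≤ x → ‖fresnel x‖ ≤ B := by
  obtain ⟨L, hL⟩ := exists_tendsto_fresnel
  obtain ⟨N, hN⟩ := eventually_atTop.1 (hL.norm.eventually (ge_mem_nhds (lt_add_one ‖L‖)))
  obtain ⟨B, hB⟩ := isCompact_Icc.exists_bound_of_continuousOn (s := Icc 0 N)
    continuous_fresnel.continuousOn
  refine ⟨max B (‖L‖ + 1), fun x hx => ?_⟩
  rcases le_total N x with h | h
  · exact (hN x h).trans (le_max_right _ _)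
  · exact (hB x ⟨hx, h⟩).trans (le_max_left _ _)

/-- The Fresnel integral. -/
theorem tendsto_fresnel :
    Tendsto fresnel atTop (𝓝 ((2 * Real.pi * Complex.I : ℂ) ^ (1 / 2 : ℂ) / 2)) := by
  obtain ⟨L, hL⟩ := exists_tendsto_fresnel
  obtain ⟨B, hB⟩ := exists_norm_fresnel_le
  suffices h : L = (2 * Real.pi * Complex.I : ℂ) ^ (1 / 2 : ℂ) / 2 by rwa [← h]
  have hgi : Integrable fun v : ℝ => v * Real.exp (-1 * v ^ 2) :=
    integrable_mul_exp_neg_mul_sq one_pos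
  -- Abelian averaging: 2v e^{-v²} is a probability density on (0, ∞), so the averages of `fresnel
  -- (n * v)` also tend to `L`.
  have hmass : ∫ v in Ioi (0 : ℝ), ((2 * v * Real.exp (-v ^ 2) : ℝ) : ℂ) * L = L := by
    rw [integral_mul_const]
    have h0 : ∫ v in Ioi (0 : ℝ), 2 * v * Real.exp (-v ^ 2) = 0 - (-Real.exp (-0 ^ 2)) := by
      refine integral_Ioi_of_hasDerivAt_of_tendsto' (f := fun v => -Real.exp (-v ^ 2))
        (fun v _ => ?_) ?_ ?_
      · have := ((hasDerivAt_pow 2 v).neg.exp).neg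
        refine this.congr_deriv ?_
        simp; ring
      · refine ((hgi.const_mul 2).integrableOn).congr (ae_of_all _ fun v => ?_)
        simp [mul_assoc]
      · have : Tendsto (fun v : ℝ => v ^ 2) atTop atTop := tendsto_pow_atTop two_ne_zero
        simpa using (Real.tendsto_exp_neg_atTop_nhds_zero.comp this).neg
    rw [integral_complex_ofReal, h0]; simp
  have hD : Tendsto (fun n : ℝ => ∫ v in Ioi (0 : ℝ),
      ((2 * v * Real.exp (-v ^ 2) : ℝ) : ℂ) * fresnel (n * v)) atTop (𝓝 L) := by
    conv => rhs; rw [← hmass]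
    refine tendsto_integral_filter_of_dominated_convergence
      (fun v => 2 * (v * Real.exp (-1 * v ^ 2)) * B) ?_ ?_
      ((hgi.const_mul 2).mul_const B).integrableOn ?_
    · refine Eventually.of_forall fun n => Continuous.aestronglyMeasurable ?_
      exact (by fun_prop : Continuous fun v : ℝ => ((2 * v * Real.exp (-v ^ 2) : ℝ) : ℂ)).mul
        (continuous_fresnel.comp (by fun_prop))
    · filter_upwards [eventually_ge_atTop 0] with n hn
      filter_upwards [ae_restrict_mem measurableSet_Ioi] with v hv
      have hv0 : 0 < v := hv
      rw [norm_mul, Complex.norm_real, Real.norm_of_nonneg (by positivity)]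
      refine (mul_le_mul_of_nonneg_left (hB _ (by positivity)) (by positivity)).trans_eq ?_
      ring_nf
    · filter_upwards [ae_restrict_mem measurableSet_Ioi] with v hv
      exact (hL.comp (tendsto_id.atTop_mul_const (mem_Ioi.1 hv))).const_mul _
  -- Integrating the average by parts turns it into a complex Gaussian integral, which has a closed
  -- form.
  have hJ : ∀ n : ℝ, 0 < n → ∫ v in Ioi (0 : ℝ),
      ((2 * v * Real.exp (-v ^ 2) : ℝ) : ℂ) * fresnel (n * v) =
        ((Real.pi : ℂ) / (((n : ℂ) ^ 2)⁻¹ - Complex.I / 2)) ^ (1 / 2 : ℂ) / 2 := by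
    intro n hn
    have hn0 : (n : ℂ) ≠ 0 := by exact_mod_cast hn.ne'
    have hparts := integral_Ioi_mul_deriv_eq_deriv_mul (a := (0 : ℝ)) (a' := 0) (b' := 0)
      (u := fun v : ℝ => ((Real.exp (-v ^ 2) : ℝ) : ℂ))
      (u' := fun v : ℝ => ((-(2 * v * Real.exp (-v ^ 2)) : ℝ) : ℂ))
      (v := fun v => fresnel (n * v))
      (v' := fun v => n * Complex.exp (Complex.I * ((n * v : ℝ) : ℂ) ^ 2 / 2))
      (fun v _ => by
        have := ((hasDerivAt_pow 2 v).neg.exp).ofReal_comp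
        refine this.congr_deriv ?_
        simp only [Pi.neg_apply]
        push_cast; ring)
      (fun v _ => by
        have := (hasDerivAt_fresnel (n * v)).scomp v ((hasDerivAt_id v).const_mul n)
        refine this.congr_deriv ?_
        simp)
      (by
        have hg : Integrable fun v : ℝ => n * Real.exp (-1 * v ^ 2) :=
          (integrable_exp_neg_mul_sq one_pos).const_mul n
        refine (hg.mono' (Continuous.aestronglyMeasurable ?_) (ae_of_all _ fun v => ?_)).integrableOn
        · simp only [Pi.mul_def]; fun_prop
        · simp only [Pi.mul_apply]
          rw [norm_mul, norm_mul, norm_exp_I_sq, Complex.norm_real, Complex.norm_real,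
            Real.norm_of_nonneg (Real.exp_nonneg _), Real.norm_of_nonneg hn.le]
          apply le_of_eq; ring_nf)
      (by
        have hg := (hgi.const_mul 2).mul_const B
        refine hg.integrableOn.mono' (Continuous.aestronglyMeasurable ?_) ?_
        · simp only [Pi.mul_def]
          exact (by fun_prop : Continuous fun v : ℝ =>
            ((-(2 * v * Real.exp (-v ^ 2)) : ℝ) : ℂ)).mul (continuous_fresnel.comp (by fun_prop))
        · filter_upwards [ae_restrict_mem measurableSet_Ioi] with v hv
          have hv0 : 0 < v := hv
          simp only [Pi.mul_apply]
          rw [norm_mul, Complex.norm_real, norm_neg, Real.norm_of_nonneg (by positivity)]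
          refine (mul_le_mul_of_nonneg_left (hB _ (by positivity)) (by positivity)).trans_eq ?_
          ring_nf)
      (by
        have hc : Continuous ((fun v : ℝ => ((Real.exp (-v ^ 2) : ℝ) : ℂ)) *
            fun v => fresnel (n * v)) :=
          Continuous.mul (by fun_prop) (continuous_fresnel.comp (by fun_prop))
        have := hc.tendsto 0
        simp only [Pi.mul_apply, mul_zero, fresnel_zero] at this
        exact this.mono_left nhdsWithin_le_nhds)
      (by
        have h1 : Tendsto (fun v : ℝ => ((Real.exp (-v ^ 2) : ℝ) : ℂ)) atTop (𝓝 0) := by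
          have : Tendsto (fun v : ℝ => v ^ 2) atTop atTop := tendsto_pow_atTop two_ne_zero
          have h2 := Real.tendsto_exp_neg_atTop_nhds_zero.comp this
          exact (Complex.continuous_ofReal.tendsto' 0 0 rfl).comp h2
        have h2 := hL.comp (tendsto_id.const_mul_atTop hn)
        have := h1.mul h2
        rwa [zero_mul] at this)
    have hre : (0 : ℝ) < (1 - Complex.I * (n : ℂ) ^ 2 / 2).re := by
      have : (Complex.I * (n : ℂ) ^ 2 / 2) = ((n ^ 2 / 2 : ℝ) : ℂ) * Complex.I := by
        push_cast; ring
      rw [this, Complex.sub_re, Complex.re_ofReal_mul]; simp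
    have hgauss := integral_gaussian_complex_Ioi hre
    have hlhs : ∫ v in Ioi (0 : ℝ), ((Real.exp (-v ^ 2) : ℝ) : ℂ) *
        (n * Complex.exp (Complex.I * ((n * v : ℝ) : ℂ) ^ 2 / 2)) =
        n * (((Real.pi : ℂ) / (1 - Complex.I * (n : ℂ) ^ 2 / 2)) ^ (1 / 2 : ℂ) / 2) := by
      rw [← hgauss, ← integral_const_mul]
      refine integral_congr_ae (ae_of_all _ fun v => ?_)
      simp only
      rw [Complex.ofReal_exp, mul_left_comm, ← Complex.exp_add]
      congr 2
      push_cast; ring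
    have hw0 : (Real.pi : ℂ) / (1 - Complex.I * (n : ℂ) ^ 2 / 2) ≠ 0 := by
      refine div_ne_zero (by exact_mod_cast Real.pi_ne_zero) fun h => ?_
      rw [h] at hre; simp at hre
    -- The principal square root is multiplicative in a positive real factor, here n².
    have hsq : (n : ℂ) * ((Real.pi : ℂ) / (1 - Complex.I * (n : ℂ) ^ 2 / 2)) ^ (1 / 2 : ℂ) =
        ((Real.pi : ℂ) / (((n : ℂ) ^ 2)⁻¹ - Complex.I / 2)) ^ (1 / 2 : ℂ) := by
      have hrw : (Real.pi : ℂ) / (((n : ℂ) ^ 2)⁻¹ - Complex.I / 2) =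
          ((n ^ 2 : ℝ) : ℂ) * ((Real.pi : ℂ) / (1 - Complex.I * (n : ℂ) ^ 2 / 2)) := by
        have h1 : (1 - Complex.I * (n : ℂ) ^ 2 / 2) ≠ 0 := by
          intro h; rw [h] at hre; simp at hre
        have h2 : ((n : ℂ) ^ 2)⁻¹ - Complex.I / 2 ≠ 0 := by
          intro h
          apply h1
          have : 1 - Complex.I * (n : ℂ) ^ 2 / 2 = (n : ℂ) ^ 2 * (((n : ℂ) ^ 2)⁻¹ - Complex.I / 2) := by
            field_simp
          rw [this, h, mul_zero]
        rw [div_eq_iff h2]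
        push_cast
        have h3 : (n : ℂ) ^ 2 * (Real.pi / (1 - Complex.I * (n : ℂ) ^ 2 / 2)) *
            (((n : ℂ) ^ 2)⁻¹ - Complex.I / 2) = Real.pi / (1 - Complex.I * (n : ℂ) ^ 2 / 2) *
            (1 - Complex.I * (n : ℂ) ^ 2 / 2) := by
          rw [show (1 - Complex.I * (n : ℂ) ^ 2 / 2) = (n : ℂ) ^ 2 * (((n : ℂ) ^ 2)⁻¹ - Complex.I / 2)
            by field_simp]
          ring
        rw [h3, div_mul_cancel₀ _ h1]
      rw [hrw, Complex.cpow_def_of_ne_zero (mul_ne_zero (by exact_mod_cast (pow_pos hn 2).ne') hw0),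
        Complex.cpow_def_of_ne_zero hw0, Complex.log_ofReal_mul (pow_pos hn 2) hw0, add_mul,
        Complex.exp_add]
      congr 1
      rw [Real.log_pow]
      push_cast
      rw [show (2 : ℂ) * (Real.log n : ℂ) * (1 / 2) = ((Real.log n : ℝ) : ℂ) by ring,
        ← Complex.ofReal_exp, Real.exp_log hn]
    rw [hlhs] at hparts
    rw [← hsq, mul_div_assoc, hparts]
    simp only [Complex.ofReal_neg, neg_mul, integral_neg]
    ring
  have hval : Tendsto (fun n : ℝ => ((Real.pi : ℂ) / (((n : ℂ) ^ 2)⁻¹ - Complex.I / 2)) ^ (1 / 2 : ℂ) / 2)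
      atTop (𝓝 (((Real.pi : ℂ) / (0 - Complex.I / 2)) ^ (1 / 2 : ℂ) / 2)) := by
    have hinv : Tendsto (fun n : ℝ => ((n : ℂ) ^ 2)⁻¹) atTop (𝓝 0) := by
      have h1 : Tendsto (fun n : ℝ => (n ^ 2)⁻¹) atTop (𝓝 0) :=
        tendsto_inv_atTop_zero.comp (tendsto_pow_atTop two_ne_zero)
      have := (Complex.continuous_ofReal.tendsto' 0 0 rfl).comp h1
      refine this.congr fun n => ?_
      simp
    have hI2 : (0 - Complex.I / 2 : ℂ) ≠ 0 := by simp
    refine Tendsto.div_const (Tendsto.comp (continuousAt_cpow_const ?_)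
      (tendsto_const_nhds.div (hinv.sub_const _) hI2)) 2
    -- The limiting base is 2πi, off the branch cut, so the principal power is continuous there.
    rw [show (Real.pi : ℂ) / (0 - Complex.I / 2) = ((2 * Real.pi : ℝ) : ℂ) * Complex.I by
      field_simp; simp [mul_comm]]
    right
    simp [Real.pi_ne_zero]
  have hD' := hD.congr' ((eventually_gt_atTop 0).mono fun n hn => hJ n hn)
  have := tendsto_nhds_unique hD' hval
  rw [this]
  congr 2
  field_simp; simp

/-- One half of the stationary phase asymptotics for the phase `1 - cos θ` at `θ = 0`. -/
theorem tendsto_stationaryPhase_half {g : ℝ → ℂ} (hg : ContDiff ℝ 1 g) (hg0 : g (Real.pi / 2) = 0) :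
    Tendsto (fun μ : ℝ => ∫ θ in (0 : ℝ)..Real.pi / 2, (Real.sqrt μ : ℂ) *
      (Complex.exp (Complex.I * ((μ * (1 - Real.cos θ) : ℝ) : ℂ)) * g θ)) atTop
      (𝓝 ((2 * Real.pi * Complex.I : ℂ) ^ (1 / 2 : ℂ) / 2 * g 0)) := by
  set L : ℂ := (2 * Real.pi * Complex.I : ℂ) ^ (1 / 2 : ℂ) / 2
  obtain ⟨B, hB⟩ := exists_norm_fresnel_le
  have hpi := Real.pi_pos
  have hle : (0 : ℝ) ≤ Real.pi / 2 := by positivity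
  have hcos : ∀ θ ∈ Icc (0 : ℝ) (Real.pi / 2), Real.cos (θ / 2) ≠ 0 := fun θ hθ =>
    (Real.cos_pos_of_mem_Ioo ⟨by linarith [hθ.1], by linarith [hθ.2]⟩).ne'
  -- the amplitude in the variable `2 sin (θ / 2)` and its derivative
  set h : ℝ → ℂ := fun θ => g θ / (Real.cos (θ / 2) : ℂ) with hh
  set h' : ℝ → ℂ := fun θ => (deriv g θ * (Real.cos (θ / 2) : ℂ) -
    g θ * ((-Real.sin (θ / 2) * (1 / 2) : ℝ) : ℂ)) / (Real.cos (θ / 2) : ℂ) ^ 2 with hh'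
  have hder : ∀ θ ∈ uIcc 0 (Real.pi / 2), HasDerivAt h (h' θ) θ := by
    intro θ hθ
    rw [uIcc_of_le hle] at hθ
    have h1 : HasDerivAt g (deriv g θ) θ := (hg.differentiable one_ne_zero θ).hasDerivAt
    have h2 : HasDerivAt (fun θ : ℝ => Real.cos (θ / 2)) (-Real.sin (θ / 2) * (1 / 2)) θ :=
      ((hasDerivAt_id θ).div_const 2).cos
    exact h1.div h2.ofReal_comp (by exact_mod_cast hcos θ hθ)
  have hcont' : ContinuousOn h' (uIcc 0 (Real.pi / 2)) := by
    rw [uIcc_of_le hle]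
    have hd : Continuous (deriv g) := hg.continuous_deriv le_rfl
    have hc : Continuous g := hg.continuous
    exact ContinuousOn.div (by fun_prop) (by fun_prop) fun θ hθ =>
      pow_ne_zero 2 (by exact_mod_cast hcos θ hθ)
  -- Since 1 - cos θ = 2 sin²(θ/2), the substitution s = 2√μ sin(θ/2) turns the phase into s²/2,
  -- with ds = √μ cos(θ/2) dθ.
  have hΨ : ∀ μ : ℝ, 0 < μ → ∀ θ : ℝ, HasDerivAt
      (fun θ => fresnel (2 * Real.sqrt μ * Real.sin (θ / 2)))
      ((Real.sqrt μ : ℂ) * (Complex.exp (Complex.I * ((μ * (1 - Real.cos θ) : ℝ) : ℂ)) *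
        (Real.cos (θ / 2) : ℂ))) θ := by
    intro μ hμ θ
    have h1 : HasDerivAt (fun θ : ℝ => 2 * Real.sqrt μ * Real.sin (θ / 2))
        (2 * Real.sqrt μ * (Real.cos (θ / 2) * (1 / 2))) θ :=
      (((hasDerivAt_id θ).div_const 2).sin).const_mul _
    refine ((hasDerivAt_fresnel _).scomp θ h1).congr_deriv ?_
    have h2 : Complex.I * ((2 * Real.sqrt μ * Real.sin (θ / 2) : ℝ) : ℂ) ^ 2 / 2 =
        Complex.I * ((μ * (1 - Real.cos θ) : ℝ) : ℂ) := by
      rw [mul_div_assoc]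
      congr 1
      norm_cast
      have h3 : Real.cos θ = 1 - 2 * Real.sin (θ / 2) ^ 2 := by
        have := Real.cos_two_mul (θ / 2)
        rw [show 2 * (θ / 2) = θ by ring] at this
        have h4 := Real.sin_sq_add_cos_sq (θ / 2)
        linear_combination this + 2 * h4
      rw [h3, mul_pow, mul_pow, Real.sq_sqrt hμ.le]
      ring
    rw [h2, Complex.real_smul]
    push_cast
    ring
  have hlim : Tendsto (fun μ : ℝ => ∫ θ in (0 : ℝ)..Real.pi / 2,
      h' θ * fresnel (2 * Real.sqrt μ * Real.sin (θ / 2))) atTop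
      (𝓝 (∫ θ in (0 : ℝ)..Real.pi / 2, h' θ * L)) := by
    refine intervalIntegral.tendsto_integral_filter_of_dominated_convergence
      (fun θ => ‖h' θ‖ * B) ?_ ?_ (hcont'.norm.mul continuousOn_const).intervalIntegrable ?_
    · refine Eventually.of_forall fun μ => ?_
      refine (ContinuousOn.aestronglyMeasurable ?_ measurableSet_uIoc)
      exact (hcont'.mono uIoc_subset_uIcc).mul
        (continuous_fresnel.comp (by fun_prop)).continuousOn
    · refine Eventually.of_forall fun μ => ae_of_all _ fun θ hθ => ?_
      rw [uIoc_of_le hle] at hθ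
      rw [norm_mul]
      refine mul_le_mul_of_nonneg_left (hB _ ?_) (norm_nonneg _)
      have := Real.sin_nonneg_of_nonneg_of_le_pi (x := θ / 2) (by linarith [hθ.1])
        (by linarith [hθ.2])
      positivity
    · refine ae_of_all _ fun θ hθ => ?_
      rw [uIoc_of_le hle] at hθ
      have hs : 0 < Real.sin (θ / 2) := Real.sin_pos_of_pos_of_lt_pi (by linarith [hθ.1])
        (by linarith [hθ.2])
      refine (tendsto_fresnel.comp ?_).const_mul _
      exact (Real.tendsto_sqrt_atTop.const_mul_atTop two_pos).atTop_mul_const hs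
  -- Both boundary terms vanish, at π/2 because of g and at 0 because of `fresnel_zero`. What
  -- remains is -∫ h' · fresnel, whose limit is -L ∫ h' = L g(0).
  have hint : ∫ θ in (0 : ℝ)..Real.pi / 2, h' θ * L = -(L * g 0) := by
    rw [intervalIntegral.integral_mul_const,
      intervalIntegral.integral_eq_sub_of_hasDerivAt hder hcont'.intervalIntegrable]
    simp [hh, hg0, mul_comm]
  rw [hint] at hlim
  rw [← neg_neg (L * g 0)]
  refine hlim.neg.congr' ?_
  filter_upwards [eventually_gt_atTop 0] with μ hμ
  have hparts := intervalIntegral.integral_mul_deriv_eq_deriv_mul hder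
    (fun θ _ => hΨ μ hμ θ) hcont'.intervalIntegrable
    (Continuous.intervalIntegrable (by fun_prop) _ _)
  have hend : h (Real.pi / 2) = 0 := by simp [hh, hg0]
  rw [hend] at hparts
  simp only [zero_div, Real.sin_zero, mul_zero, fresnel_zero, zero_mul, sub_zero, zero_sub]
    at hparts
  rw [← hparts]
  refine intervalIntegral.integral_congr fun θ hθ => ?_
  rw [uIcc_of_le hle] at hθ
  have hc : ((Real.cos (θ / 2) : ℝ) : ℂ) ≠ 0 := by exact_mod_cast hcos θ hθ
  simp only [hh]
  field_simp

/-- Stationary phase asymptotics for the phase `1 - cos θ` at `θ = 0`, for amplitudes that vanish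
at the end points. -/
theorem tendsto_stationaryPhase {g : ℝ → ℂ} (hg : ContDiff ℝ 1 g) (hg0 : g (Real.pi / 2) = 0)
    (hg0' : g (-(Real.pi / 2)) = 0) :
    Tendsto (fun μ : ℝ => (Real.sqrt μ : ℂ) * ∫ θ in -(Real.pi / 2)..Real.pi / 2,
      Complex.exp (Complex.I * ((μ * (1 - Real.cos θ) : ℝ) : ℂ)) * g θ) atTop
      (𝓝 ((2 * Real.pi * Complex.I : ℂ) ^ (1 / 2 : ℂ) * g 0)) := by
  have h1 := tendsto_stationaryPhase_half hg hg0
  have h2 := tendsto_stationaryPhase_half (g := fun θ => g (-θ)) (hg.comp contDiff_neg) hg0'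
  have h12 := h2.add h1
  simp only [neg_zero] at h12
  rw [← add_mul, add_halves] at h12
  refine h12.congr fun μ => ?_
  have hc : Continuous fun θ : ℝ => (Real.sqrt μ : ℂ) *
      (Complex.exp (Complex.I * ((μ * (1 - Real.cos θ) : ℝ) : ℂ)) * g θ) := by
    have := hg.continuous
    fun_prop
  have hneg := intervalIntegral.integral_comp_neg (a := 0) (b := Real.pi / 2) fun θ : ℝ =>
    (Real.sqrt μ : ℂ) * (Complex.exp (Complex.I * ((μ * (1 - Real.cos θ) : ℝ) : ℂ)) * g θ)
  simp only [Real.cos_neg, neg_zero] at hneg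
  rw [hneg, intervalIntegral.integral_add_adjacent_intervals (hc.intervalIntegrable _ _)
    (hc.intervalIntegrable _ _), intervalIntegral.integral_const_mul]

/-- The Riemann–Lebesgue lemma for the phase `cos φ` on `(0, π)`. -/
theorem tendsto_integral_exp_cos (w : ℝ → ℂ) :
    Tendsto (fun μ : ℝ => ∫ φ in Ioo 0 Real.pi,
      Complex.exp (-(Complex.I * ((μ * Real.cos φ : ℝ) : ℂ))) * w φ) atTop (𝓝 0) := by
  have hinj : InjOn Real.cos (Ioo 0 Real.pi) := Real.injOn_cos.mono Ioo_subset_Icc_self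
  have hmeas : MeasurableSet (Real.cos '' Ioo 0 Real.pi) :=
    measurableSet_Ioo.image_of_continuousOn_injOn Real.continuous_cos.continuousOn hinj
  -- Substitution u = cos φ, with 1/sin φ the inverse Jacobian. No integrability of `w` is needed:
  -- the change of variables and Riemann–Lebesgue both remain valid under the convention that
  -- non-integrable functions have integral 0.
  set W : ℝ → ℂ := (Real.cos '' Ioo 0 Real.pi).indicator fun u =>
    ((Real.sin (Real.arccos u))⁻¹ : ℂ) * w (Real.arccos u) with hW
  have hRL := (Real.tendsto_integral_exp_smul_cocompact W).comp
    ((tendsto_id.atTop_mul_const (inv_pos.2 Real.two_pi_pos)).mono_right atTop_le_cocompact)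
  refine hRL.congr fun μ => ?_
  have hcv := integral_image_eq_integral_abs_deriv_smul (s := Ioo 0 Real.pi) measurableSet_Ioo
    (fun φ _ => (Real.hasDerivAt_cos φ).hasDerivWithinAt) hinj
    (fun u => Complex.exp (-(Complex.I * ((μ * u : ℝ) : ℂ))) *
      (((Real.sin (Real.arccos u))⁻¹ : ℂ) * w (Real.arccos u)))
  have h1 : ∫ φ in Ioo 0 Real.pi, |(-Real.sin φ)| •
      (Complex.exp (-(Complex.I * ((μ * Real.cos φ : ℝ) : ℂ))) *
      (((Real.sin (Real.arccos (Real.cos φ)))⁻¹ : ℂ) * w (Real.arccos (Real.cos φ)))) =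
      ∫ φ in Ioo 0 Real.pi, Complex.exp (-(Complex.I * ((μ * Real.cos φ : ℝ) : ℂ))) * w φ := by
    refine setIntegral_congr_fun measurableSet_Ioo fun φ hφ => ?_
    have hs : 0 < Real.sin φ := Real.sin_pos_of_pos_of_lt_pi hφ.1 hφ.2
    have hs' : (Real.sin φ : ℂ) ≠ 0 := by exact_mod_cast hs.ne'
    simp only [Real.arccos_cos hφ.1.le hφ.2.le, abs_neg, abs_of_pos hs, Complex.real_smul]
    field_simp
  rw [← h1, ← hcv, ← integral_indicator hmeas]
  refine integral_congr_ae (ae_of_all _ fun u => ?_)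
  by_cases hu : u ∈ Real.cos '' Ioo 0 Real.pi
  · simp only [hW, indicator_of_mem hu, Circle.smul_def, Real.fourierChar_apply, smul_eq_mul, id]
    congr 2
    push_cast
    have := Real.pi_ne_zero
    field_simp
  · simp [hW, hu]

/-- Asymptotics of the oscillatory integral over the colatitude. -/
theorem tendsto_integral_sin_exp_cos {G : ℝ → ℂ} (hG : ContDiff ℝ 1 G) (hG0 : G Real.pi = 0) :
    Tendsto (fun μ : ℝ => Complex.exp (Complex.I * μ) * (μ * ∫ φ in Ioo 0 Real.pi,
      Complex.exp (-(Complex.I * ((μ * Real.cos φ : ℝ) : ℂ))) * (Real.sin φ * G φ))) atTop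
      (𝓝 (Complex.I * G 0)) := by
  have hle := Real.pi_pos.le
  have hd : Continuous (deriv G) := hG.continuous_deriv le_rfl
  have hRL : Tendsto (fun μ : ℝ => Complex.exp (Complex.I * μ) * (Complex.I * ∫ φ in Ioo 0 Real.pi,
      Complex.exp (-(Complex.I * ((μ * Real.cos φ : ℝ) : ℂ))) * deriv G φ)) atTop (𝓝 0) := by
    rw [tendsto_zero_iff_norm_tendsto_zero]
    have := (tendsto_integral_exp_cos (deriv G)).norm
    rw [norm_zero] at this
    refine this.congr fun μ => ?_
    rw [norm_mul, norm_mul, mul_comm Complex.I, Complex.norm_exp_ofReal_mul_I, Complex.norm_I]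
    simp
  have := hRL.const_add (Complex.I * G 0)
  rw [add_zero] at this
  refine this.congr fun μ => ?_
  -- The factor sin φ in the integrand is exactly the derivative of the phase up to constants. In
  -- the integration by parts only the endpoint φ = 0 contributes, and the remaining integral of G'
  -- tends to 0.
  have hE : ∀ φ : ℝ, HasDerivAt
      (fun φ : ℝ => Complex.exp (-(Complex.I * ((μ * Real.cos φ : ℝ) : ℂ))))
      (Complex.exp (-(Complex.I * ((μ * Real.cos φ : ℝ) : ℂ))) * (Complex.I * (μ * Real.sin φ))) φ := by
    intro φ
    have h1 := ((((Real.hasDerivAt_cos φ).const_mul μ).ofReal_comp.const_mul Complex.I).neg).cexp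
    refine h1.congr_deriv ?_
    simp
  have hparts := intervalIntegral.integral_mul_deriv_eq_deriv_mul (a := 0) (b := Real.pi)
    (fun φ _ => (hG.differentiable one_ne_zero φ).hasDerivAt) (fun φ _ => hE φ)
    (hd.intervalIntegrable _ _) (Continuous.intervalIntegrable (by fun_prop) _ _)
  rw [intervalIntegral.integral_of_le hle, intervalIntegral.integral_of_le hle,
    integral_Ioc_eq_integral_Ioo, integral_Ioc_eq_integral_Ioo, hG0, Real.cos_zero] at hparts
  have e1 : ∫ φ in Ioo 0 Real.pi, G φ *
      (Complex.exp (-(Complex.I * ((μ * Real.cos φ : ℝ) : ℂ))) * (Complex.I * (μ * Real.sin φ))) =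
      Complex.I * μ * ∫ φ in Ioo 0 Real.pi,
      Complex.exp (-(Complex.I * ((μ * Real.cos φ : ℝ) : ℂ))) * (Real.sin φ * G φ) := by
    rw [← integral_const_mul]
    congr 1; funext φ; ring
  have e2 : ∫ φ in Ioo 0 Real.pi,
      deriv G φ * Complex.exp (-(Complex.I * ((μ * Real.cos φ : ℝ) : ℂ))) =
      ∫ φ in Ioo 0 Real.pi,
      Complex.exp (-(Complex.I * ((μ * Real.cos φ : ℝ) : ℂ))) * deriv G φ := by
    congr 1; funext φ; ring
  rw [e1, e2] at hparts
  set J := ∫ φ in Ioo 0 Real.pi,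
      Complex.exp (-(Complex.I * ((μ * Real.cos φ : ℝ) : ℂ))) * (Real.sin φ * G φ)
  set K := ∫ φ in Ioo 0 Real.pi,
      Complex.exp (-(Complex.I * ((μ * Real.cos φ : ℝ) : ℂ))) * deriv G φ
  have hexp : Complex.exp (Complex.I * μ) * Complex.exp (-(Complex.I * ((μ * 1 : ℝ) : ℂ))) = 1 := by
    rw [← Complex.exp_add]; simp
  have hI := Complex.I_mul_I
  linear_combination (Complex.I * Complex.exp (Complex.I * μ)) * hparts -
    Complex.I * G 0 * hexp - Complex.exp (Complex.I * μ) * μ * J * hI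

/-! ### Oscillatory integrals over the sphere. -/

/-- With first basis vector k/|k|, the product k·q is |k| times the cosine of the angular
coordinate. -/
theorem exists_frame (d : ℕ) [NeZero d] (q : Sphere d) :
    ∃ b : OrthonormalBasis (Fin d) ℝ (Space d), b 0 = q := by
  have hq : ‖(q : Space d)‖ = 1 := norm_eq_of_mem_sphere q
  obtain ⟨b, hb⟩ := Orthonormal.exists_orthonormalBasis_extension_of_card_eq (ι := Fin d)
    (𝕜 := ℝ) (E := Space d) (by simp) (v := fun _ => (q : Space d)) (s := {0})
    ⟨fun _ => hq, fun i j hij => absurd (Subsingleton.elim i j) hij⟩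
  exact ⟨b, hb 0 rfl⟩

/-- Passes from regularity on the manifold ℝ × S^{d-1} to ordinary differentiability along a
parametrization. -/
theorem contDiff_comp_sphere {d : ℕ} [NeZero d] {U : ℝ → Sphere d → ℂ} {n : ℕ∞ω}
    (hU : ContMDiff (𝓘(ℝ, ℝ).prod (𝓡 (d - 1))) 𝓘(ℝ, ℂ) n
      (fun p : ℝ × Sphere d => U p.1 p.2))
    {E : Type*} [NormedAddCommGroup E] [NormedSpace ℝ E] {ρ : E → ℝ} {Q : E → Sphere d}
    (hρ : ContDiff ℝ n ρ) (hQ : ContDiff ℝ n (fun x => (Q x : Space d))) :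
    ContDiff ℝ n (fun x => U (ρ x) (Q x)) := by
  rw [← contMDiff_iff_contDiff]
  have h1 : ContMDiff 𝓘(ℝ, E) (𝓡 (d - 1)) n Q :=
    ContMDiff.codRestrict_sphere (n := d - 1) hQ.contMDiff fun x => (Q x).2
  exact hU.comp (hρ.contMDiff.prodMk h1)

theorem contDiff_circlePoint (b : OrthonormalBasis (Fin 2) ℝ (Space 2)) {n : ℕ∞ω} :
    ContDiff ℝ n (fun θ => (circlePoint b θ : Space 2)) := by
  refine b.repr.symm.contDiff.comp ?_
  rw [contDiff_euclidean]
  intro i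
  fin_cases i
  · exact Real.contDiff_cos
  · exact Real.contDiff_sin

theorem contDiff_spherePoint (b : OrthonormalBasis (Fin 3) ℝ (Space 3)) {n : ℕ∞ω} :
    ContDiff ℝ n (fun p : ℝ × ℝ => (spherePoint b p.1 p.2 : Space 3)) := by
  refine b.repr.symm.contDiff.comp ?_
  rw [contDiff_euclidean]
  have h1 : ContDiff ℝ n fun p : ℝ × ℝ => p.1 := contDiff_fst
  have h2 : ContDiff ℝ n fun p : ℝ × ℝ => p.2 := contDiff_snd
  intro i
  fin_cases i
  · exact h1.cos
  · exact h1.sin.mul h2.cos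
  · exact h1.sin.mul h2.sin

theorem inner_circlePoint (b : OrthonormalBasis (Fin 2) ℝ (Space 2)) (θ : ℝ) :
    inner ℝ (b 0) (circlePoint b θ : Space 2) = Real.cos θ := by
  rw [← b.repr_apply_apply]
  simp [circlePoint]

theorem inner_spherePoint (b : OrthonormalBasis (Fin 3) ℝ (Space 3)) (φ θ : ℝ) :
    inner ℝ (b 0) (spherePoint b φ θ : Space 3) = Real.cos φ := by
  rw [← b.repr_apply_apply]
  simp [spherePoint]

theorem circlePoint_zero (b : OrthonormalBasis (Fin 2) ℝ (Space 2)) {q : Sphere 2}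
    (hb : b 0 = q) : circlePoint b 0 = q := by
  ext1
  change b.repr.symm !₂[Real.cos 0, Real.sin 0] = _
  rw [← hb, ← b.sum_repr_symm]
  simp [Fin.sum_univ_two]

theorem spherePoint_zero (b : OrthonormalBasis (Fin 3) ℝ (Space 3)) {q : Sphere 3}
    (hb : b 0 = q) (θ : ℝ) : spherePoint b 0 θ = q := by
  ext1
  change b.repr.symm !₂[Real.cos 0, Real.sin 0 * Real.cos θ, Real.sin 0 * Real.sin θ] = _
  rw [← hb, ← b.sum_repr_symm]
  simp [Fin.sum_univ_three]

theorem inner_eq_norm_mul {d : ℕ} {k : Space d} (hk : k ≠ 0) (x : Space d) :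
    inner ℝ k x = ‖k‖ * inner ℝ (direction k hk : Space d) x := by
  conv_lhs => rw [← norm_smul_direction hk]
  rw [real_inner_smul_left]

/-- Parametric integrals of continuously differentiable functions. -/
theorem contDiff_one_parametric_integral {f : ℝ × ℝ → ℂ} (hf : ContDiff ℝ 1 f) (a b : ℝ) :
    ContDiff ℝ 1 (fun x => ∫ θ in a..b, f (x, θ)) := by
  set f' : ℝ × ℝ → ℂ := fun p => fderiv ℝ f p (1, 0) with hf'
  have hf'c : Continuous f' := (hf.continuous_fderiv one_ne_zero).clm_apply continuous_const
  have hpart : ∀ x θ, HasDerivAt (fun x => f (x, θ)) (f' (x, θ)) x := by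
    intro x θ
    have h1 : HasDerivAt (fun x : ℝ => (x, θ)) ((1 : ℝ), (0 : ℝ)) x :=
      (hasDerivAt_id x).prodMk (hasDerivAt_const x θ)
    exact (hf.differentiable one_ne_zero (x, θ)).hasFDerivAt.comp_hasDerivAt x h1
  have hder : ∀ x, HasDerivAt (fun x => ∫ θ in a..b, f (x, θ)) (∫ θ in a..b, f' (x, θ)) x := by
    intro x₀
    obtain ⟨C, hC⟩ := ((isCompact_Icc (a := x₀ - 1) (b := x₀ + 1)).prod
      (isCompact_uIcc (a := a) (b := b))).exists_bound_of_continuousOn hf'c.continuousOn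
    refine (intervalIntegral.hasDerivAt_integral_of_dominated_loc_of_deriv_le
      (bound := fun _ => C) (F' := fun x θ => f' (x, θ))
      (Icc_mem_nhds (sub_one_lt x₀) (lt_add_one x₀)) ?_ ?_ ?_ ?_ ?_ ?_).2
    · exact Eventually.of_forall fun x =>
        (hf.continuous.comp (Continuous.prodMk_right x)).aestronglyMeasurable
    · exact (hf.continuous.comp (Continuous.prodMk_right x₀)).intervalIntegrable _ _
    · exact (hf'c.comp (Continuous.prodMk_right x₀)).aestronglyMeasurable
    · exact ae_of_all _ fun θ hθ x hx => hC (x, θ) ⟨hx, uIoc_subset_uIcc hθ⟩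
    · exact intervalIntegrable_const
    · exact ae_of_all _ fun θ _ x _ => hpart x θ
  rw [contDiff_one_iff_deriv]
  refine ⟨fun x => (hder x).differentiableAt, ?_⟩
  rw [show deriv (fun x => ∫ θ in a..b, f (x, θ)) = fun x => ∫ θ in a..b, f' (x, θ) from
    funext fun x => (hder x).deriv]
  exact intervalIntegral.continuous_parametric_intervalIntegral_of_continuous' hf'c a b

/-- Asymptotics of the spherical integral in dimension one. -/
theorem tendsto_sphere_integral_one {U : ℝ → Sphere 1 → ℂ}
    (hneg : ∀ ξ q, ξ < 0 → U ξ q = 0) {k : Space 1} (hk : k ≠ 0) :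
    Tendsto (fun T : ℝ => Complex.exp (Complex.I * ((‖k‖ * T : ℝ) : ℂ)) *
      (((T ^ ((((1 : ℕ) : ℝ) - 1) / 2) : ℝ) : ℂ) * ∫ q : Sphere 1,
        Complex.exp (-(Complex.I * ((T * inner ℝ k q : ℝ) : ℂ))) * U (inner ℝ k q) q
          ∂surfaceMeasure 1)) atTop
      (𝓝 (((‖k‖ : ℂ) / (2 * Real.pi * Complex.I)) ^ (-((((1 : ℕ) : ℂ) - 1) / 2)) *
        U ‖k‖ (direction k hk))) := by
  -- In dimension one the expression does not depend on T: the point -k/|k| carries a negative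
  -- frequency, and the phase at k/|k| cancels exactly.
  refine tendsto_const_nhds.congr fun T => ?_
  set q := direction k hk
  have hq : inner ℝ (q : Space 1) (q : Space 1) = 1 := by
    rw [real_inner_self_eq_norm_sq, norm_eq_of_mem_sphere q, one_pow]
  have hkpos : 0 < ‖k‖ := norm_pos_iff.2 hk
  rw [surfaceMeasure_one q, integral_add_measure (integrable_dirac enorm_lt_top)
    (integrable_dirac enorm_lt_top), integral_dirac, integral_dirac]
  have h1 : inner ℝ k (q : Space 1) = ‖k‖ := by rw [inner_eq_norm_mul hk, hq, mul_one]
  have h2 : inner ℝ k ((-q : Sphere 1) : Space 1) = -‖k‖ := by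
    rw [show ((-q : Sphere 1) : Space 1) = -(q : Space 1) from rfl, inner_neg_right, h1]
  rw [h1, h2, hneg (-‖k‖) _ (neg_neg_of_pos hkpos)]
  simp only [Nat.cast_one, sub_self, zero_div, neg_zero, Complex.cpow_zero, Real.rpow_zero,
    mul_zero, add_zero, one_mul, Complex.ofReal_one]
  rw [← mul_assoc, ← Complex.exp_add]
  push_cast
  rw [show Complex.I * ((‖k‖ : ℂ) * T) + -(Complex.I * ((T : ℂ) * ‖k‖)) = 0 by ring]
  simp

/-- The principal power splits because κ > 0 and 2πi has argument π/2 ≠ π, so the logarithm of its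
inverse is the negative of its logarithm. -/
theorem cpow_neg_half_phase {κ : ℝ} (hκ : 0 < κ) :
    ((κ : ℂ) / (2 * Real.pi * Complex.I)) ^ (-((((2 : ℕ) : ℂ) - 1) / 2)) =
      (2 * Real.pi * Complex.I : ℂ) ^ (1 / 2 : ℂ) / (Real.sqrt κ : ℂ) := by
  have hw0 : (2 * Real.pi * Complex.I : ℂ) ≠ 0 := by simp [Real.pi_ne_zero]
  have hκ0 : (κ : ℂ) ≠ 0 := by exact_mod_cast hκ.ne'
  have harg : (2 * Real.pi * Complex.I : ℂ).arg ≠ Real.pi := by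
    rw [show (2 * Real.pi * Complex.I : ℂ) = ((2 * Real.pi : ℝ) : ℂ) * Complex.I by push_cast; ring,
      Complex.arg_real_mul _ Real.two_pi_pos, Complex.arg_I]
    linarith [Real.pi_pos]
  rw [show (-((((2 : ℕ) : ℂ) - 1) / 2)) = -(1 / 2 : ℂ) by norm_num,
    Complex.cpow_def_of_ne_zero (div_ne_zero hκ0 hw0), div_eq_mul_inv,
    Complex.log_ofReal_mul hκ (inv_ne_zero hw0), Complex.log_inv _ harg,
    Complex.cpow_def_of_ne_zero hw0,
    show ((Real.log κ : ℂ) + -Complex.log (2 * Real.pi * Complex.I)) * -(1 / 2) =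
      Complex.log (2 * Real.pi * Complex.I) * (1 / 2) - ((Real.log κ / 2 : ℝ) : ℂ) by
        push_cast; ring, Complex.exp_sub, ← Complex.ofReal_exp]
  rw [Real.sqrt_eq_rpow, Real.rpow_def_of_pos hκ]
  congr 4
  ring

/-- Asymptotics of the spherical integral in dimension two. -/
theorem tendsto_sphere_integral_two {U : ℝ → Sphere 2 → ℂ}
    (hU : ContMDiff (𝓘(ℝ, ℝ).prod (𝓡 (2 - 1))) 𝓘(ℝ, ℂ) ((2 - 1 : ℕ) : ℕ∞)
      (fun p : ℝ × Sphere 2 => U p.1 p.2))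
    (hneg : ∀ ξ q, ξ < 0 → U ξ q = 0) {k : Space 2} (hk : k ≠ 0) :
    Tendsto (fun T : ℝ => Complex.exp (Complex.I * ((‖k‖ * T : ℝ) : ℂ)) *
      (((T ^ ((((2 : ℕ) : ℝ) - 1) / 2) : ℝ) : ℂ) * ∫ q : Sphere 2,
        Complex.exp (-(Complex.I * ((T * inner ℝ k q : ℝ) : ℂ))) * U (inner ℝ k q) q
          ∂surfaceMeasure 2)) atTop
      (𝓝 (((‖k‖ : ℂ) / (2 * Real.pi * Complex.I)) ^ (-((((2 : ℕ) : ℂ) - 1) / 2)) *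
        U ‖k‖ (direction k hk))) := by
  obtain ⟨b, hb⟩ := exists_frame 2 (direction k hk)
  have hkpos : 0 < ‖k‖ := norm_pos_iff.2 hk
  have hpi := Real.pi_pos
  have hin : ∀ θ, inner ℝ k (circlePoint b θ : Space 2) = ‖k‖ * Real.cos θ := fun θ => by
    rw [inner_eq_norm_mul hk, ← hb, inner_circlePoint]
  set g : ℝ → ℂ := fun θ => U (‖k‖ * Real.cos θ) (circlePoint b θ) with hg
  have hgC : ContDiff ℝ 1 g :=
    contDiff_comp_sphere (n := 1) hU (contDiff_const.mul Real.contDiff_cos) (contDiff_circlePoint b)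
  have hgz : ∀ θ, Real.cos θ < 0 → g θ = 0 := fun θ hθ =>
    hneg _ _ (mul_neg_of_pos_of_neg hkpos hθ)
  -- The amplitude vanishes where cos θ < 0, hence by continuity at ±π/2; these are the end-point
  -- conditions of the stationary phase lemma.
  have hg1 : g (Real.pi / 2) = 0 := by
    have h1 : Tendsto g (𝓝[>] (Real.pi / 2)) (𝓝 (g (Real.pi / 2))) :=
      (hgC.continuous.tendsto _).mono_left nhdsWithin_le_nhds
    refine tendsto_nhds_unique h1 (tendsto_const_nhds.congr' ?_)
    filter_upwards [Ioo_mem_nhdsGT (show Real.pi / 2 < Real.pi by linarith)] with θ hθ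
    exact (hgz θ (Real.cos_neg_of_pi_div_two_lt_of_lt hθ.1 (by linarith [hθ.2]))).symm
  have hg2 : g (-(Real.pi / 2)) = 0 := by
    have h1 : Tendsto g (𝓝[<] (-(Real.pi / 2))) (𝓝 (g (-(Real.pi / 2)))) :=
      (hgC.continuous.tendsto _).mono_left nhdsWithin_le_nhds
    refine tendsto_nhds_unique h1 (tendsto_const_nhds.congr' ?_)
    filter_upwards [Ioo_mem_nhdsLT (show -Real.pi < -(Real.pi / 2) by linarith)] with θ hθ
    refine (hgz θ ?_).symm
    rw [← Real.cos_neg]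
    exact Real.cos_neg_of_pi_div_two_lt_of_lt (by linarith [hθ.2]) (by linarith [hθ.1])
  -- The large parameter is μ = |k|T; dividing by √|k| leaves the required √T.
  have hmain := ((tendsto_stationaryPhase hgC hg1 hg2).comp
    (tendsto_id.const_mul_atTop hkpos)).div_const (Real.sqrt ‖k‖ : ℂ)
  have hg0 : g 0 = U ‖k‖ (direction k hk) := by
    simp only [hg, Real.cos_zero, mul_one, circlePoint_zero b hb]
  rw [hg0] at hmain
  rw [cpow_neg_half_phase hkpos, div_mul_eq_mul_div]
  refine hmain.congr' ?_
  filter_upwards [eventually_gt_atTop 0] with T hT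
  have hUc : Continuous (fun q : Sphere 2 =>
      Complex.exp (-(Complex.I * ((T * inner ℝ k (q : Space 2) : ℝ) : ℂ))) *
        U (inner ℝ k (q : Space 2)) q) := by
    have h1 : Continuous fun q : Sphere 2 => U (inner ℝ k (q : Space 2)) q :=
      hU.continuous.comp (by fun_prop : Continuous fun q : Sphere 2 =>
        (inner ℝ k (q : Space 2), q))
    exact Continuous.mul (by fun_prop) h1
  rw [← (measurePreserving_circlePoint b).map_eq, integral_map
    (measurable_circlePoint b).aemeasurable hUc.aestronglyMeasurable]
  simp only [hin]
  have hsub : Ioc (-(Real.pi / 2)) (Real.pi / 2) ⊆ Ioo (-Real.pi) Real.pi := fun θ hθ =>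
    ⟨by linarith [hθ.1], by linarith [hθ.2]⟩
  have hres : ∫ θ in Ioo (-Real.pi) Real.pi,
      Complex.exp (-(Complex.I * ((T * (‖k‖ * Real.cos θ) : ℝ) : ℂ))) * g θ =
      ∫ θ in -(Real.pi / 2)..Real.pi / 2,
      Complex.exp (-(Complex.I * ((T * (‖k‖ * Real.cos θ) : ℝ) : ℂ))) * g θ := by
    rw [intervalIntegral.integral_of_le (by linarith)]
    refine (setIntegral_eq_of_subset_of_forall_sdiff_eq_zero measurableSet_Ioo hsub
      fun θ hθ => ?_)
    suffices h : g θ = 0 by rw [h, mul_zero]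
    rcases lt_or_ge (Real.pi / 2) θ with h | h
    · exact hgz θ (Real.cos_neg_of_pi_div_two_lt_of_lt h (by linarith [hθ.1.2]))
    rcases (not_lt.1 fun h' => hθ.2 ⟨h', h⟩ : θ ≤ -(Real.pi / 2)).lt_or_eq with h' | h'
    · refine hgz θ ?_
      rw [← Real.cos_neg]
      exact Real.cos_neg_of_pi_div_two_lt_of_lt (by linarith) (by linarith [hθ.1.1])
    · rw [h', hg2]
  change _ = _ * (_ * ∫ θ in Ioo (-Real.pi) Real.pi,
      Complex.exp (-(Complex.I * ((T * (‖k‖ * Real.cos θ) : ℝ) : ℂ))) * g θ)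
  rw [hres]
  have hsq : T ^ ((((2 : ℕ) : ℝ) - 1) / 2) = Real.sqrt T := by
    rw [Real.sqrt_eq_rpow]; norm_num
  have hk0 : (Real.sqrt ‖k‖ : ℂ) ≠ 0 := by exact_mod_cast (Real.sqrt_pos.2 hkpos).ne'
  rw [hsq]
  simp only [Function.comp_apply, id]
  rw [Real.sqrt_mul hkpos.le, Complex.ofReal_mul, mul_assoc, mul_div_cancel_left₀ _ hk0,
    mul_left_comm]
  congr 1
  rw [← intervalIntegral.integral_const_mul]
  refine intervalIntegral.integral_congr fun θ _ => ?_
  rw [← mul_assoc, ← Complex.exp_add]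
  congr 2
  push_cast
  ring

/-- An oscillatory spherical integral in polar coordinates. -/
theorem sphere_integral_eq {k : Space 3} (hk : k ≠ 0) {b : OrthonormalBasis (Fin 3) ℝ (Space 3)}
    (hb : b 0 = direction k hk) {F : Sphere 3 → ℂ} (hF : Integrable F (surfaceMeasure 3)) (T : ℝ) :
    ∫ q : Sphere 3, Complex.exp (-(Complex.I * ((T * inner ℝ k q : ℝ) : ℂ))) * F q
        ∂surfaceMeasure 3 =
      ∫ φ in Ioo 0 Real.pi, Complex.exp (-(Complex.I * ((‖k‖ * T * Real.cos φ : ℝ) : ℂ))) *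
        (Real.sin φ * ∫ θ in -Real.pi..Real.pi, F (spherePoint b φ θ)) := by
  have hmp := measurePreserving_spherePoint b
  have hE : Continuous fun q : Sphere 3 =>
      Complex.exp (-(Complex.I * ((T * inner ℝ k (q : Space 3) : ℝ) : ℂ))) := by fun_prop
  have hint : Integrable (fun q : Sphere 3 =>
      Complex.exp (-(Complex.I * ((T * inner ℝ k (q : Space 3) : ℝ) : ℂ))) * F q)
      (surfaceMeasure 3) := by
    refine hF.bdd_mul hE.aestronglyMeasurable (c := 1) (ae_of_all _ fun q => ?_)
    rw [← mul_neg_one, mul_assoc, mul_comm, ← Complex.ofReal_one, ← Complex.ofReal_neg,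
      ← Complex.ofReal_mul, Complex.norm_exp_ofReal_mul_I]
  have hint' := (hmp.integrable_comp hint.1).2 hint
  rw [← hmp.map_eq, integral_map hmp.measurable.aemeasurable (by rw [hmp.map_eq]; exact hint.1)]
  rw [angularMeasure] at hint' ⊢
  rw [integral_prod _ (by exact hint'), integral_withDensity_eq_integral_toReal_smul (by fun_prop)
    (by simp)]
  refine setIntegral_congr_fun measurableSet_Ioo fun φ hφ => ?_
  have hs : 0 ≤ Real.sin φ := (Real.sin_pos_of_pos_of_lt_pi hφ.1 hφ.2).le
  have hin : ∀ θ, inner ℝ k (spherePoint b φ θ : Space 3) = ‖k‖ * Real.cos φ := fun θ => by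
    rw [inner_eq_norm_mul hk, ← hb, inner_spherePoint]
  simp only [hin, ENNReal.toReal_ofReal hs, Complex.real_smul]
  rw [integral_const_mul, intervalIntegral.integral_of_le (by linarith [Real.pi_pos]),
    integral_Ioc_eq_integral_Ioo]
  rw [show T * (‖k‖ * Real.cos φ) = ‖k‖ * T * Real.cos φ by ring]
  ring

/-- The oscillatory spherical integral of an integrable function tends to zero. -/
theorem tendsto_sphere_integral_zero {k : Space 3} (hk : k ≠ 0) {M : Sphere 3 → ℂ}
    (hM : Integrable M (surfaceMeasure 3)) :
    Tendsto (fun T : ℝ => ∫ q : Sphere 3,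
        Complex.exp (-(Complex.I * ((T * inner ℝ k q : ℝ) : ℂ))) * M q ∂surfaceMeasure 3) atTop
      (𝓝 0) := by
  obtain ⟨b, hb⟩ := exists_frame 3 (direction k hk)
  refine ((tendsto_integral_exp_cos fun φ : ℝ => (Real.sin φ : ℂ) *
    ∫ θ in -Real.pi..Real.pi, M (spherePoint b φ θ)).comp
    (tendsto_id.const_mul_atTop (norm_pos_iff.2 hk))).congr fun T => ?_
  exact (sphere_integral_eq hk hb hM T).symm

/-- Asymptotics of the spherical integral in dimension three. -/
theorem tendsto_sphere_integral_three {U : ℝ → Sphere 3 → ℂ}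
    (hU : ContMDiff (𝓘(ℝ, ℝ).prod (𝓡 (3 - 1))) 𝓘(ℝ, ℂ) ((3 - 1 : ℕ) : ℕ∞)
      (fun p : ℝ × Sphere 3 => U p.1 p.2))
    (hneg : ∀ ξ q, ξ < 0 → U ξ q = 0) {k : Space 3} (hk : k ≠ 0) :
    Tendsto (fun T : ℝ => Complex.exp (Complex.I * ((‖k‖ * T : ℝ) : ℂ)) *
      (((T ^ ((((3 : ℕ) : ℝ) - 1) / 2) : ℝ) : ℂ) * ∫ q : Sphere 3,
        Complex.exp (-(Complex.I * ((T * inner ℝ k q : ℝ) : ℂ))) * U (inner ℝ k q) q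
          ∂surfaceMeasure 3)) atTop
      (𝓝 (((‖k‖ : ℂ) / (2 * Real.pi * Complex.I)) ^ (-((((3 : ℕ) : ℂ) - 1) / 2)) *
        U ‖k‖ (direction k hk))) := by
  obtain ⟨b, hb⟩ := exists_frame 3 (direction k hk)
  have hkpos : 0 < ‖k‖ := norm_pos_iff.2 hk
  have hk0 : (‖k‖ : ℂ) ≠ 0 := by exact_mod_cast hkpos.ne'
  have hpi := Real.pi_pos
  have hUc : Continuous fun q : Sphere 3 => U (inner ℝ k (q : Space 3)) q :=
    hU.continuous.comp (by fun_prop : Continuous fun q : Sphere 3 =>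
      (inner ℝ k (q : Space 3), q))
  have hUi : Integrable (fun q : Sphere 3 => U (inner ℝ k (q : Space 3)) q) (surfaceMeasure 3) :=
    hUc.integrable_of_hasCompactSupport (HasCompactSupport.of_compactSpace _)
  have hin : ∀ φ θ, inner ℝ k (spherePoint b φ θ : Space 3) = ‖k‖ * Real.cos φ := fun φ θ => by
    rw [inner_eq_norm_mul hk, ← hb, inner_spherePoint]
  set G : ℝ → ℂ := fun φ => ∫ θ in -Real.pi..Real.pi,
    U (‖k‖ * Real.cos φ) (spherePoint b φ θ) with hG
  have hGC : ContDiff ℝ 1 G := by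
    refine contDiff_one_parametric_integral
      (f := fun p : ℝ × ℝ => U (‖k‖ * Real.cos p.1) (spherePoint b p.1 p.2)) ?_ _ _
    refine contDiff_comp_sphere (hU.of_le ?_)
      (contDiff_const.mul (contDiff_fst.cos)) (contDiff_spherePoint b)
    norm_cast
  -- At the south pole the frequency is -|k| < 0.
  have hGpi : G Real.pi = 0 := by
    simp only [hG, Real.cos_pi, mul_neg, mul_one]
    simp [hneg _ _ (neg_neg_of_pos hkpos)]
  -- At the north pole every longitude gives the same point, whence 2π; together with i/|k| this is
  -- (|k|/(2πi))^{-1}.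
  have hG0 : G 0 = 2 * Real.pi * U ‖k‖ (direction k hk) := by
    simp only [hG, Real.cos_zero, mul_one, spherePoint_zero b hb]
    rw [intervalIntegral.integral_const, Complex.real_smul]
    push_cast; ring
  have hmain := ((tendsto_integral_sin_exp_cos hGC hGpi).comp
    (tendsto_id.const_mul_atTop hkpos)).div_const (‖k‖ : ℂ)
  rw [hG0] at hmain
  have hlim : ((‖k‖ : ℂ) / (2 * Real.pi * Complex.I)) ^ (-((((3 : ℕ) : ℂ) - 1) / 2)) *
      U ‖k‖ (direction k hk) =
      Complex.I * (2 * Real.pi * U ‖k‖ (direction k hk)) / (‖k‖ : ℂ) := by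
    rw [show (-((((3 : ℕ) : ℂ) - 1) / 2)) = -1 by norm_num, Complex.cpow_neg_one]
    field_simp
  rw [hlim]
  refine hmain.congr fun T => ?_
  rw [sphere_integral_eq hk hb hUi T]
  have hT : T ^ ((((3 : ℕ) : ℝ) - 1) / 2) = T := by norm_num
  rw [hT]
  simp only [Function.comp_apply, id, hin]
  rw [mul_div_assoc]
  congr 1
  rw [Complex.ofReal_mul ‖k‖ T, mul_assoc, mul_div_cancel_left₀ _ hk0]

/-! ### Integrability of the moments of a profile. -/

instance (d : ℕ) : SFinite (profileMeasure d) := by unfold profileMeasure; infer_instance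

/-- A slicewise bound of a measurable function of `(z, q)` holds almost everywhere. -/
theorem ae_profileMeasure_of_slices {d : ℕ} {v : ℝ × Sphere d → ℂ} {D : ℝ → ℝ}
    (hv : AEStronglyMeasurable v (profileMeasure d)) (hD : Measurable D)
    (h : ∀ q, ∀ᵐ z : ℝ, ‖v (z, q)‖ ≤ D z) : ∀ᵐ p ∂profileMeasure d, ‖v p‖ ≤ D p.1 := by
  -- The iterated form of the almost-everywhere statement requires a measurable set, so the bound is
  -- proved for a measurable representative. The factors are swapped because the hypothesis concerns
  -- slices at fixed q.
  set v' := hv.mk v with hv'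
  have hmk : ∀ᵐ p ∂profileMeasure d, v p = v' p := hv.ae_eq_mk
  have hv'm : Measurable v' := hv.stronglyMeasurable_mk.measurable
  have hswap : MeasurePreserving Prod.swap ((surfaceMeasure d).prod (volume : Measure ℝ))
      (profileMeasure d) := Measure.measurePreserving_swap
  have h1 : ∀ᵐ r ∂(surfaceMeasure d).prod (volume : Measure ℝ), v r.swap = v' r.swap :=
    hswap.quasiMeasurePreserving.ae hmk
  have h2 : ∀ᵐ q ∂surfaceMeasure d, ∀ᵐ z : ℝ, v (z, q) = v' (z, q) :=
    Measure.ae_ae_of_ae_prod h1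
  have hset : MeasurableSet {r : Sphere d × ℝ | ‖v' r.swap‖ ≤ D r.2} :=
    measurableSet_le (hv'm.comp measurable_swap).norm (hD.comp measurable_snd)
  have h3 : ∀ᵐ r ∂(surfaceMeasure d).prod (volume : Measure ℝ), ‖v' r.swap‖ ≤ D r.2 := by
    rw [Measure.ae_prod_iff_ae_ae hset]
    filter_upwards [h2] with q hq
    filter_upwards [hq, h q] with z hz hz'
    exact hz ▸ hz'
  have hswap' : MeasurePreserving Prod.swap (profileMeasure d)
      ((surfaceMeasure d).prod (volume : Measure ℝ)) := Measure.measurePreserving_swap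
  have h4 : ∀ᵐ p ∂profileMeasure d, ‖v' p‖ ≤ D p.1 := hswap'.quasiMeasurePreserving.ae h3
  filter_upwards [hmk, h4] with p hp hp'
  rw [hp]; exact hp'

/-- Moments of a decaying profile are integrable. -/
theorem integrable_pow_mul_profile {d : ℕ} {v : ℝ × Sphere d → ℂ} {C α : ℝ} (hα : 0 < α)
    (hv : AEStronglyMeasurable v (profileMeasure d))
    (h : ∀ q, ∀ᵐ z : ℝ, ‖v (z, q)‖ ≤ C * (1 + |z|) ^ (-(d : ℝ) - α)) {j : ℕ} (hj : j + 1 ≤ d) :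
    Integrable (fun p => (p.1 : ℂ) ^ j * v p) (profileMeasure d) := by
  have hae := ae_profileMeasure_of_slices hv (by fun_prop) h
  -- Since j ≤ d - 1, |z|^j (1+|z|)^{-d-α} ≤ (1+|z|)^{-1-α}. The constant is |C| because no sign of
  -- C is assumed here.
  have hdom : Integrable (fun z : ℝ => |C| * (1 + ‖z‖) ^ (-(1 + α))) :=
    (integrable_one_add_norm (by simpa using hα)).const_mul _
  refine (hdom.comp_fst (surfaceMeasure d)).mono' ?_ ?_
  · exact (Measurable.aestronglyMeasurable (by fun_prop)).mul hv
  · filter_upwards [hae] with p hp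
    have h1 : (1 : ℝ) ≤ 1 + |p.1| := by linarith [abs_nonneg p.1]
    have h0 : (0 : ℝ) < 1 + |p.1| := by linarith
    have hdj : (j : ℝ) + 1 ≤ d := by exact_mod_cast hj
    rw [norm_mul, norm_pow, Complex.norm_real, Real.norm_eq_abs]
    calc |p.1| ^ j * ‖v p‖ ≤ (1 + |p.1|) ^ j * (|C| * (1 + |p.1|) ^ (-(d : ℝ) - α)) := by
          gcongr
          · linarith
          · exact hp.trans (by gcongr; exact le_abs_self C)
      _ = |C| * (1 + |p.1|) ^ ((j : ℝ) + (-(d : ℝ) - α)) := by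
          rw [Real.rpow_add h0, Real.rpow_natCast]; ring
      _ ≤ |C| * (1 + |p.1|) ^ (-(1 + α)) := by
          refine mul_le_mul_of_nonneg_left (Real.rpow_le_rpow_of_exponent_le h1 ?_) (abs_nonneg C)
          linarith

/-! ### The shell in polar coordinates and its L² bound. -/

/-- The shell amplitude in the coordinates `(z, q)`, with `T = ct`. -/
def shellProfile {d : ℕ} (v : ℝ × Sphere d → ℂ) (T : ℝ) : ℝ × Sphere d → ℂ :=
  fun p => (1 / (T ^ (((d : ℝ) - 1) / 2) : ℝ) : ℂ) * (Iio T ×ˢ univ).indicator v p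

/-- At t = τ/ε² the slow time ε²t equals τ, and the cut-off |x| < 2ct reads z < T. -/
theorem shell_ae_eq {d : ℕ} [NeZero d] (q₀ : Sphere d) (c ε τ : ℝ) (hε : 0 < ε)
    (V : ℝ → Sphere d → ℝ → ℂ) :
    (fun x => shell c ε V x (τ / ε ^ 2)) =ᵐ[volume]
      shellProfile (fun p => V p.1 p.2 τ) (c * (τ / ε ^ 2)) ∘
        fun x => (‖x‖ - c * (τ / ε ^ 2), dirOf q₀ x) := by
  have h0 : ∀ᵐ x : Space d, x ≠ 0 := by
    rw [ae_iff]; simp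
  filter_upwards [h0] with x hx
  have hτ : ε ^ 2 * (τ / ε ^ 2) = τ := by field_simp
  simp only [Function.comp_apply, shell, hx, shellProfile, dirOf_of_ne q₀ hx, hτ, ne_eq, not_false_eq_true, dif_pos]
  by_cases h : ‖x‖ < 2 * c * (τ / ε ^ 2)
  · have h' : ‖x‖ - c * (τ / ε ^ 2) < c * (τ / ε ^ 2) := by linarith
    simp [h, h', indicator]
  · have h' : ¬ (‖x‖ - c * (τ / ε ^ 2) < c * (τ / ε ^ 2)) := by
      intro h'; apply h; linarith
    simp [h, h', indicator]

/-- The density of `shellMeasure d T` with respect to `profileMeasure d`. -/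
def shellDensity (d : ℕ) (T z : ℝ) : ENNReal :=
  (Ioi (-T)).indicator (fun z => ENNReal.ofReal ((z + T) ^ (d - 1))) z

theorem measurable_shellDensity (d : ℕ) (T : ℝ) : Measurable (shellDensity d T) :=
  Measurable.indicator (by fun_prop) measurableSet_Ioi

theorem shellMeasure_eq (d : ℕ) (T : ℝ) :
    shellMeasure d T = (profileMeasure d).withDensity fun p => shellDensity d T p.1 := by
  rw [profileMeasure, ← prod_withDensity_left (measurable_shellDensity d T), shellMeasure,
    ← withDensity_indicator measurableSet_Ioi]
  rfl

theorem shellMeasure_absolutelyContinuous (d : ℕ) (T : ℝ) :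
    shellMeasure d T ≪ profileMeasure d := by
  rw [shellMeasure_eq]; exact withDensity_absolutelyContinuous _ _

/-- On -T < z < T the density (z+T)^(d-1) is at most (2T)^(d-1); this is where the cut-off at |x| =
2ct enters. -/
theorem shellMeasure_restrict_le (d : ℕ) (T : ℝ) :
    (shellMeasure d T).restrict (Iio T ×ˢ univ) ≤
      ENNReal.ofReal ((2 * T) ^ (d - 1)) • profileMeasure d := by
  rw [shellMeasure_eq, restrict_withDensity (measurableSet_Iio.prod MeasurableSet.univ),
    ← withDensity_const]
  refine (withDensity_mono (g := fun _ => ENNReal.ofReal ((2 * T) ^ (d - 1))) ?_).trans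
    (Measure.le_iff.2 fun s hs => ?_)
  · filter_upwards [ae_restrict_mem (measurableSet_Iio.prod MeasurableSet.univ)] with p hp
    have hpT : p.1 < T := hp.1
    by_cases h : -T < p.1
    · simp only [shellDensity, indicator, mem_Ioi, h, if_true]
      refine ENNReal.ofReal_le_ofReal (pow_le_pow_left₀ (by linarith) (by linarith) _)
    · simp [shellDensity, indicator, h]
  · simp only [withDensity_const, Measure.smul_apply, smul_eq_mul]
    gcongr
    exact Measure.restrict_le_self

theorem aestronglyMeasurable_shellProfile {d : ℕ} {v : ℝ × Sphere d → ℂ}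
    (hv : AEStronglyMeasurable v (profileMeasure d)) (T : ℝ) :
    AEStronglyMeasurable (shellProfile v T) (shellMeasure d T) :=
  ((hv.indicator (measurableSet_Iio.prod MeasurableSet.univ)).const_mul _).mono_ac
    (shellMeasure_absolutelyContinuous d T)

theorem integrable_shellProfile {d : ℕ} {v : ℝ × Sphere d → ℂ}
    (hv : Integrable v (profileMeasure d)) (T : ℝ) :
    Integrable (shellProfile v T) (shellMeasure d T) := by
  refine Integrable.const_mul ?_ _
  rw [integrable_indicator_iff (measurableSet_Iio.prod MeasurableSet.univ)]
  exact (hv.smul_measure ENNReal.ofReal_ne_top).mono_measure (shellMeasure_restrict_le d T)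

/-- The amplitude T^{-(d-1)/2} compensates the square root of the density bound (2T)^(d-1), so the
constant is independent of T. -/
theorem eLpNorm_shellProfile_le {d : ℕ} [NeZero d] {v : ℝ × Sphere d → ℂ} {T : ℝ} (hT : 0 < T) :
    eLpNorm (shellProfile v T) 2 (shellMeasure d T) ≤
      ENNReal.ofReal (2 ^ (((d : ℝ) - 1) / 2)) * eLpNorm v 2 (profileMeasure d) := by
  have h1 : eLpNorm (shellProfile v T) 2 (shellMeasure d T) =
      ENNReal.ofReal ((T ^ (((d : ℝ) - 1) / 2))⁻¹) *
        eLpNorm v 2 ((shellMeasure d T).restrict (Iio T ×ˢ univ)) := by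
    have : shellProfile v T = (1 / (T ^ (((d : ℝ) - 1) / 2) : ℝ) : ℂ) •
        (Iio T ×ˢ univ).indicator v := rfl
    rw [this, eLpNorm_const_smul, eLpNorm_indicator_eq_eLpNorm_restrict
      (measurableSet_Iio.prod MeasurableSet.univ)]
    congr 1
    rw [← ofReal_norm, norm_div, norm_one, Complex.norm_real,
      Real.norm_of_nonneg (by positivity), one_div]
  have hd : (0 : ℝ) ≤ (2 * T) ^ (d - 1) := by positivity
  rw [h1]
  refine (mul_le_mul_right (eLpNorm_mono_measure _ (shellMeasure_restrict_le d T)) _).trans ?_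
  rw [eLpNorm_smul_measure_of_ne_top (by norm_num), smul_eq_mul, ← mul_assoc,
    ENNReal.ofReal_rpow_of_nonneg hd (by positivity), ← ENNReal.ofReal_mul (by positivity)]
  gcongr
  have hd1 : ((d - 1 : ℕ) : ℝ) = (d : ℝ) - 1 := by
    rw [Nat.cast_sub (NeZero.one_le)]; simp
  rw [← Real.rpow_natCast, ← Real.rpow_mul (by positivity), hd1,
    Real.mul_rpow two_pos.le hT.le]
  simp only [one_div, ENNReal.toReal_inv, ENNReal.toReal_ofNat]
  rw [← div_eq_mul_inv]
  rw [mul_comm, mul_assoc, mul_inv_cancel₀ (by positivity), mul_one]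

/-! ### The Fourier transform of the shell and removal of the radial weight. -/

/-- The cut-off radial weight `1_{|z| < T} (1 + z/T)^{d-1}`. -/
def shellWeight (d : ℕ) (T z : ℝ) : ℝ :=
  (Ioo (-T) T).indicator (fun z => (1 + z / T) ^ (d - 1)) z

theorem norm_exp_neg_I_mul (x : ℝ) : ‖Complex.exp (-(Complex.I * (x : ℂ)))‖ = 1 := by
  rw [← mul_neg, ← Complex.ofReal_neg, mul_comm, Complex.norm_exp_ofReal_mul_I]

/-- The oscillating factor `e^{-i(z+T)k·q}`. -/
def shellPhase {d : ℕ} (k : Space d) (T : ℝ) (p : ℝ × Sphere d) : ℂ :=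
  Complex.exp (-(Complex.I * (((p.1 + T) * inner ℝ k p.2 : ℝ) : ℂ)))

theorem norm_shellPhase {d : ℕ} (k : Space d) (T : ℝ) (p : ℝ × Sphere d) :
    ‖shellPhase k T p‖ = 1 := norm_exp_neg_I_mul _

theorem continuous_shellPhase {d : ℕ} (k : Space d) (T : ℝ) : Continuous (shellPhase k T) := by
  unfold shellPhase; fun_prop

/-- The Fourier transform of the shell as an oscillatory integral over `(z, q)`. -/
theorem spaceFourier_shell {d : ℕ} [NeZero d] {c ε τ : ℝ} (hc : 0 < c) (hε : 0 < ε) (hτ : 0 < τ)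
    {V : ℝ → Sphere d → ℝ → ℂ}
    (hv : AEStronglyMeasurable (fun p : ℝ × Sphere d => V p.1 p.2 τ) (profileMeasure d))
    (k : Space d) {T : ℝ} (hT : T = c * (τ / ε ^ 2)) :
    spaceFourier (fun x => shell c ε V x (τ / ε ^ 2)) k =
      ((T ^ (((d : ℝ) - 1) / 2) : ℝ) : ℂ) * ∫ p, (shellWeight d T p.1 : ℂ) *
        (V p.1 p.2 τ * shellPhase k T p) ∂profileMeasure d := by
  have hT0 : 0 < T := by rw [hT]; positivity
  obtain ⟨q₀⟩ : Nonempty (Sphere d) := (NormedSpace.sphere_nonempty.2 zero_le_one).to_subtype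
  have hmp := measurePreserving_shellCoord q₀ T
  set v : ℝ × Sphere d → ℂ := fun p => V p.1 p.2 τ with hvdef
  have h1 : spaceFourier (fun x => shell c ε V x (τ / ε ^ 2)) k =
      ∫ x : Space d, (fun p => shellProfile v T p * shellPhase k T p) (‖x‖ - T, dirOf q₀ x) := by
    refine integral_congr_ae ?_
    have h0 : ∀ᵐ x : Space d, x ≠ 0 := by
      rw [ae_iff]; simp
    filter_upwards [shell_ae_eq q₀ c ε τ hε V, h0] with x hx hx0
    rw [hx, ← hT]
    simp only [Function.comp_apply, shellPhase, dirOf_of_ne q₀ hx0, sub_add_cancel]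
    rw [← real_inner_smul_right, norm_smul_direction hx0]
  rw [h1, ← integral_map (f := fun p => shellProfile v T p * shellPhase k T p) hmp.measurable.aemeasurable
    (by rw [hmp.map_eq]
        exact (aestronglyMeasurable_shellProfile hv T).mul (continuous_shellPhase k T).aestronglyMeasurable),
    hmp.map_eq, shellMeasure_eq,
    integral_withDensity_eq_integral_toReal_smul
      (by exact (measurable_shellDensity d T).comp measurable_fst)
      (ae_of_all _ fun p => by
        simp only [shellDensity, indicator]; split_ifs <;> simp), ← integral_const_mul]
  refine integral_congr_ae (ae_of_all _ fun p => ?_)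
  have hd1 : ((d - 1 : ℕ) : ℝ) = (d : ℝ) - 1 := by
    rw [Nat.cast_sub (NeZero.one_le)]; simp
  simp only [shellProfile, shellDensity, shellWeight, Complex.real_smul]
  by_cases ha : -T < p.1
  · by_cases hb : p.1 < T
    · rw [indicator_of_mem (mem_Ioi.2 ha), indicator_of_mem (show p ∈ Iio T ×ˢ univ from ⟨hb, trivial⟩),
        indicator_of_mem (show p.1 ∈ Ioo (-T) T from ⟨ha, hb⟩),
        ENNReal.toReal_ofReal (pow_nonneg (by linarith) _)]
      -- Factoring T out of the Jacobian changes the prefactor from T^{-(d-1)/2} to T^{(d-1)/2}.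
      have hkey : (p.1 + T) ^ (d - 1) * (1 / T ^ (((d : ℝ) - 1) / 2)) =
          T ^ (((d : ℝ) - 1) / 2) * (1 + p.1 / T) ^ (d - 1) := by
        have e1 : p.1 + T = T * (1 + p.1 / T) := by field_simp; ring
        have e2 : T ^ (d - 1) = T ^ (((d : ℝ) - 1) / 2) * T ^ (((d : ℝ) - 1) / 2) := by
          rw [← Real.rpow_add hT0, add_halves, ← hd1, Real.rpow_natCast]
        have e3 : T ^ (((d : ℝ) - 1) / 2) ≠ 0 := (Real.rpow_pos_of_pos hT0 _).ne'
        rw [e1, mul_pow, e2]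
        field_simp
      have hkey' := congrArg (fun r : ℝ => (r : ℂ)) hkey
      push_cast at hkey'
      push_cast
      linear_combination (V p.1 p.2 τ * shellPhase k T p) * hkey'
    · rw [indicator_of_notMem (show p ∉ Iio T ×ˢ univ from fun h => hb h.1),
        indicator_of_notMem (show p.1 ∉ Ioo (-T) T from fun h => hb h.2)]
      simp
  · rw [indicator_of_notMem (show p.1 ∉ Ioi (-T) from ha),
      indicator_of_notMem (show p.1 ∉ Ioo (-T) T from fun h => ha h.1)]
    simp

theorem integrable_mul_shellPhase {d : ℕ} {f : ℝ × Sphere d → ℂ}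
    (hf : Integrable f (profileMeasure d)) (k : Space d) (T : ℝ) :
    Integrable (fun p => f p * shellPhase k T p) (profileMeasure d) :=
  hf.mul_bdd (c := 1) (continuous_shellPhase k T).aestronglyMeasurable
    (ae_of_all _ fun p => (norm_shellPhase k T p).le)

/-- Fubini: the shift T contributes e^{-iTk·q}, and the inner integral is the transform in z at
frequency k·q. -/
theorem integral_mul_shellPhase {d : ℕ} {f : ℝ × Sphere d → ℂ}
    (hf : Integrable f (profileMeasure d)) (k : Space d) (T : ℝ) :
    ∫ p, f p * shellPhase k T p ∂profileMeasure d =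
      ∫ q : Sphere d, Complex.exp (-(Complex.I * ((T * inner ℝ k q : ℝ) : ℂ))) *
        (∫ z : ℝ, f (z, q) * Complex.exp (-(Complex.I * (inner ℝ k q : ℝ) * z)))
          ∂surfaceMeasure d := by
  rw [profileMeasure, integral_prod_symm _ (integrable_mul_shellPhase hf k T)]
  congr 1
  funext q
  rw [← integral_const_mul]
  congr 1
  funext z
  rw [shellPhase, mul_left_comm, ← Complex.exp_add]
  congr 2
  push_cast
  ring

/-- Equality holds inside the cut-off; outside it the weight is 0 and |z|/T ≥ 1. -/
theorem abs_shellWeight_two_sub_le {T : ℝ} (hT : 0 < T) (z : ℝ) :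
    |shellWeight 2 T z - 1| ≤ |z| / T := by
  by_cases h : z ∈ Ioo (-T) T
  · rw [shellWeight, indicator_of_mem h]
    norm_num [abs_div, abs_of_pos hT]
  · rw [shellWeight, indicator_of_notMem h, le_div_iff₀ hT]
    have : T ≤ |z| := by
      by_contra h'
      exact h (abs_lt.1 (not_le.1 h'))
    norm_num
    exact this

/-- Inside the cut-off the remainder is exactly (z/T)². Outside, 1 + 2s ≤ 3s² for s = |z|/T ≥ 1,
which is the source of the 3. -/
theorem abs_shellWeight_three_sub_le {T : ℝ} (hT : 0 < T) (z : ℝ) :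
    |shellWeight 3 T z - 1 - 2 * (z / T)| ≤ 3 * (z / T) ^ 2 := by
  by_cases h : z ∈ Ioo (-T) T
  · rw [shellWeight, indicator_of_mem h]
    rw [show (1 + z / T) ^ (3 - 1) - 1 - 2 * (z / T) = (z / T) ^ 2 by norm_num; ring,
      abs_of_nonneg (sq_nonneg _)]
    nlinarith [sq_nonneg (z / T)]
  · rw [shellWeight, indicator_of_notMem h]
    have h1 : T ≤ |z| := by
      by_contra h'
      exact h (abs_lt.1 (not_le.1 h'))
    have h2 : 1 ≤ |z / T| := by
      rw [abs_div, abs_of_pos hT, le_div_iff₀ hT, one_mul]; exact h1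
    have h3 : (z / T) ^ 2 = |z / T| ^ 2 := (sq_abs _).symm
    rw [h3]
    have h4 : |0 - 1 - 2 * (z / T)| ≤ 1 + 2 * |z / T| := by
      calc |0 - 1 - 2 * (z / T)| = |1 + 2 * (z / T)| := by rw [← abs_neg]; ring_nf
        _ ≤ |1| + |2 * (z / T)| := abs_add_le _ _
        _ = _ := by rw [abs_one, abs_mul, abs_two]
    nlinarith

theorem measurable_shellWeight (d : ℕ) (T : ℝ) : Measurable (shellWeight d T) :=
  Measurable.indicator (by fun_prop) measurableSet_Ioo

theorem abs_shellWeight_le {T : ℝ} (hT : 0 < T) (d : ℕ) (z : ℝ) :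
    |shellWeight d T z| ≤ 2 ^ (d - 1) := by
  by_cases h : z ∈ Ioo (-T) T
  · have h1 : 0 ≤ 1 + z / T := by
      have : -1 ≤ z / T := by rw [le_div_iff₀ hT]; linarith [h.1]
      linarith
    have h2 : 1 + z / T ≤ 2 := by
      have : z / T ≤ 1 := by rw [div_le_iff₀ hT]; linarith [h.2]
      linarith
    rw [shellWeight, indicator_of_mem h, abs_of_nonneg (pow_nonneg h1 _)]
    exact pow_le_pow_left₀ h1 h2 _
  · rw [shellWeight, indicator_of_notMem h, abs_zero]; positivity

theorem integrable_shellWeight_mul {d : ℕ} {f : ℝ × Sphere d → ℂ}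
    (hf : Integrable f (profileMeasure d)) {T : ℝ} (hT : 0 < T) :
    Integrable (fun p => (shellWeight d T p.1 : ℂ) * f p) (profileMeasure d) := by
  refine hf.bdd_mul (c := 2 ^ (d - 1)) (Measurable.aestronglyMeasurable ?_)
    (ae_of_all _ fun p => ?_)
  · exact Complex.measurable_ofReal.comp ((measurable_shellWeight d T).comp measurable_fst)
  · rw [Complex.norm_real]; exact abs_shellWeight_le hT d p.1

/-- In dimension one the radial cut-off may be dropped. -/
theorem tendsto_shellWeight_one {f : ℝ × Sphere 1 → ℂ} (hf : Integrable f (profileMeasure 1))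
    (k : Space 1) :
    Tendsto (fun T : ℝ => ((T ^ ((((1 : ℕ) : ℝ) - 1) / 2) : ℝ) : ℂ) *
      (∫ p, (shellWeight 1 T p.1 : ℂ) * (f p * shellPhase k T p) ∂profileMeasure 1 -
        ∫ p, f p * shellPhase k T p ∂profileMeasure 1)) atTop (𝓝 0) := by
  have hdct : Tendsto (fun T : ℝ => ∫ p, ((shellWeight 1 T p.1 : ℂ) - 1) * (f p * shellPhase k T p)
      ∂profileMeasure 1) atTop (𝓝 (∫ _p : ℝ × Sphere 1, (0 : ℂ) ∂profileMeasure 1)) := by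
    refine tendsto_integral_filter_of_dominated_convergence (fun p => 2 * ‖f p‖) ?_ ?_
      (hf.norm.const_mul 2) ?_
    · refine Eventually.of_forall fun T => AEStronglyMeasurable.mul
        (Measurable.aestronglyMeasurable ?_) (integrable_mul_shellPhase hf k T).1
      exact (Complex.measurable_ofReal.comp
        ((measurable_shellWeight 1 T).comp measurable_fst)).sub_const 1
    · filter_upwards [eventually_gt_atTop 0] with T hT
      refine ae_of_all _ fun p => ?_
      rw [norm_mul, norm_mul, norm_shellPhase, mul_one]
      refine mul_le_mul_of_nonneg_right ((norm_sub_le _ _).trans ?_) (norm_nonneg _)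
      rw [Complex.norm_real, norm_one, Real.norm_eq_abs]
      have := abs_shellWeight_le hT 1 p.1
      norm_num at this
      linarith
    · refine ae_of_all _ fun p => tendsto_const_nhds.congr' ?_
      filter_upwards [eventually_gt_atTop |p.1|] with T hT
      have h : p.1 ∈ Ioo (-T) T := abs_lt.1 hT
      simp [shellWeight, h]
  rw [integral_zero] at hdct
  refine hdct.congr' ?_
  filter_upwards [eventually_gt_atTop 0] with T hT
  have hi := integrable_mul_shellPhase hf k T
  rw [← integral_sub (integrable_shellWeight_mul hi hT) hi]
  simp only [Nat.cast_one, sub_self, zero_div, Real.rpow_zero, Complex.ofReal_one, one_mul,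
    sub_mul]

/-- In dimension two the radial weight may be replaced by `1`. -/
theorem tendsto_shellWeight_two {f : ℝ × Sphere 2 → ℂ} (hf : Integrable f (profileMeasure 2))
    (hf1 : Integrable (fun p => (p.1 : ℂ) ^ 1 * f p) (profileMeasure 2)) (k : Space 2) :
    Tendsto (fun T : ℝ => ((T ^ ((((2 : ℕ) : ℝ) - 1) / 2) : ℝ) : ℂ) *
      (∫ p, (shellWeight 2 T p.1 : ℂ) * (f p * shellPhase k T p) ∂profileMeasure 2 -
        ∫ p, f p * shellPhase k T p ∂profileMeasure 2)) atTop (𝓝 0) := by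
  have hz : Tendsto (fun T : ℝ => T ^ (-(1 / 2 : ℝ)) *
      ∫ p, ‖(p.1 : ℂ) ^ 1 * f p‖ ∂profileMeasure 2) atTop (𝓝 0) := by
    have := (tendsto_rpow_neg_atTop (y := 1 / 2) (by norm_num)).mul_const
      (∫ p, ‖(p.1 : ℂ) ^ 1 * f p‖ ∂profileMeasure 2)
    rwa [zero_mul] at this
  refine squeeze_zero_norm' ?_ hz
  filter_upwards [eventually_gt_atTop 0] with T hT
  have hi := integrable_mul_shellPhase hf k T
  have hTp : 0 ≤ T ^ ((((2 : ℕ) : ℝ) - 1) / 2) := by positivity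
  rw [← integral_sub (integrable_shellWeight_mul hi hT) hi, norm_mul, Complex.norm_real,
    Real.norm_of_nonneg hTp]
  have hb : ‖∫ p, ((shellWeight 2 T p.1 : ℂ) * (f p * shellPhase k T p) - f p * shellPhase k T p)
      ∂profileMeasure 2‖ ≤ ∫ p, T⁻¹ * ‖(p.1 : ℂ) ^ 1 * f p‖ ∂profileMeasure 2 := by
    refine norm_integral_le_of_norm_le (hf1.norm.const_mul _) (ae_of_all _ fun p => ?_)
    rw [← sub_one_mul, norm_mul, norm_mul, norm_shellPhase, mul_one, ← Complex.ofReal_one,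
      ← Complex.ofReal_sub, Complex.norm_real, norm_mul, norm_pow, Complex.norm_real, pow_one,
      ← mul_assoc]
    refine mul_le_mul_of_nonneg_right ?_ (norm_nonneg _)
    refine (abs_shellWeight_two_sub_le hT p.1).trans_eq ?_
    rw [Real.norm_eq_abs]; ring
  rw [integral_const_mul] at hb
  refine (mul_le_mul_of_nonneg_left hb hTp).trans_eq ?_
  rw [← mul_assoc, ← Real.rpow_neg_one, ← Real.rpow_add hT]
  norm_num

/-- In dimension three the radial weight may be replaced by `1`. -/
theorem tendsto_shellWeight_three {f : ℝ × Sphere 3 → ℂ} (hf : Integrable f (profileMeasure 3))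
    (hf1 : Integrable (fun p => (p.1 : ℂ) ^ 1 * f p) (profileMeasure 3))
    (hf2 : Integrable (fun p => (p.1 : ℂ) ^ 2 * f p) (profileMeasure 3))
    {k : Space 3} (hk : k ≠ 0) :
    Tendsto (fun T : ℝ => ((T ^ ((((3 : ℕ) : ℝ) - 1) / 2) : ℝ) : ℂ) *
      (∫ p, (shellWeight 3 T p.1 : ℂ) * (f p * shellPhase k T p) ∂profileMeasure 3 -
        ∫ p, f p * shellPhase k T p ∂profileMeasure 3)) atTop (𝓝 0) := by
  -- the contribution of the linear term of the weight
  have hlin : Tendsto (fun T : ℝ => 2 * ∫ p, (p.1 : ℂ) ^ 1 * f p * shellPhase k T p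
      ∂profileMeasure 3) atTop (𝓝 0) := by
    have hM : Integrable (fun q : Sphere 3 => ∫ z : ℝ, (z : ℂ) ^ 1 * f (z, q) *
        Complex.exp (-(Complex.I * (inner ℝ k (q : Space 3) : ℝ) * z))) (surfaceMeasure 3) := by
      -- At T = 0 the phase is just e^{-iz k·q}, so Fubini gives integrability in q of the
      -- transformed first moment, as Riemann–Lebesgue requires.
      have h := (integrable_mul_shellPhase hf1 k 0).integral_prod_right
      refine h.congr (ae_of_all _ fun q => ?_)
      simp only [shellPhase]
      congr 1
      funext z
      congr 2
      push_cast
      ring_nf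
    have := (tendsto_sphere_integral_zero hk hM).const_mul 2
    rw [mul_zero] at this
    refine this.congr fun T => ?_
    rw [integral_mul_shellPhase hf1 k T]
  -- The remainder is O((z/T)²), so against the prefactor T the second moment gives O(1/T).
  have hquad : Tendsto (fun T : ℝ => (T : ℂ) * ∫ p,
      ((shellWeight 3 T p.1 - 1 - 2 * (p.1 / T) : ℝ) : ℂ) * (f p * shellPhase k T p)
      ∂profileMeasure 3) atTop (𝓝 0) := by
    have hz : Tendsto (fun T : ℝ => T⁻¹ *
        (3 * ∫ p, ‖(p.1 : ℂ) ^ 2 * f p‖ ∂profileMeasure 3)) atTop (𝓝 0) := by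
      have := tendsto_inv_atTop_zero.mul_const
        (3 * ∫ p, ‖(p.1 : ℂ) ^ 2 * f p‖ ∂profileMeasure 3)
      rwa [zero_mul] at this
    refine squeeze_zero_norm' ?_ hz
    filter_upwards [eventually_gt_atTop 0] with T hT
    have hb : ‖∫ p, ((shellWeight 3 T p.1 - 1 - 2 * (p.1 / T) : ℝ) : ℂ) * (f p * shellPhase k T p)
        ∂profileMeasure 3‖ ≤ ∫ p, (3 * (T⁻¹) ^ 2) * ‖(p.1 : ℂ) ^ 2 * f p‖ ∂profileMeasure 3 := by
      refine norm_integral_le_of_norm_le (hf2.norm.const_mul _) (ae_of_all _ fun p => ?_)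
      rw [norm_mul, norm_mul, norm_shellPhase, mul_one, Complex.norm_real, norm_mul, norm_pow,
        Complex.norm_real, ← mul_assoc]
      refine mul_le_mul_of_nonneg_right ?_ (norm_nonneg _)
      refine (abs_shellWeight_three_sub_le hT p.1).trans_eq ?_
      rw [Real.norm_eq_abs, sq_abs]; ring
    rw [integral_const_mul] at hb
    rw [norm_mul, Complex.norm_real, Real.norm_of_nonneg hT.le]
    refine (mul_le_mul_of_nonneg_left hb hT.le).trans_eq ?_
    field_simp
  have hsum := hlin.add hquad
  rw [add_zero] at hsum
  refine hsum.congr' ?_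
  filter_upwards [eventually_gt_atTop 0] with T hT
  have hi := integrable_mul_shellPhase hf k T
  have hi1 := integrable_mul_shellPhase hf1 k T
  have hw := integrable_shellWeight_mul hi hT
  have hT' : (T : ℂ) ≠ 0 := by exact_mod_cast hT.ne'
  have hexp : T ^ ((((3 : ℕ) : ℝ) - 1) / 2) = T := by norm_num
  have hsplit : ∫ p, ((shellWeight 3 T p.1 - 1 - 2 * (p.1 / T) : ℝ) : ℂ) *
      (f p * shellPhase k T p) ∂profileMeasure 3 =
      ∫ p, (shellWeight 3 T p.1 : ℂ) * (f p * shellPhase k T p) ∂profileMeasure 3 -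
        ∫ p, f p * shellPhase k T p ∂profileMeasure 3 -
        2 / T * ∫ p, (p.1 : ℂ) ^ 1 * f p * shellPhase k T p ∂profileMeasure 3 := by
    have hwi : Integrable (fun p => (shellWeight 3 T p.1 : ℂ) * (f p * shellPhase k T p) -
        f p * shellPhase k T p) (profileMeasure 3) := hw.sub hi
    rw [← integral_const_mul, ← integral_sub hw hi, ← integral_sub hwi (hi1.const_mul _)]
    congr 1
    funext p
    push_cast
    ring
  rw [hexp, hsplit]
  field_simp
  ring

/-! ### Assembly of the asymptotics and the uniform bounds. -/

theorem tendsto_shellTime {c τ : ℝ} (hc : 0 < c) (hτ : 0 < τ) :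
    Tendsto (fun ε : ℝ => c * (τ / ε ^ 2)) (𝓝[>] 0) atTop := by
  have h : Tendsto (fun ε : ℝ => (ε⁻¹) ^ 2) (𝓝[>] 0) atTop :=
    (tendsto_pow_atTop two_ne_zero).comp tendsto_inv_nhdsGT_zero
  refine ((h.const_mul_atTop hτ).const_mul_atTop hc).congr fun ε => ?_
  rw [inv_pow, div_eq_mul_inv]

theorem ProfileAssumption.memLp {d : ℕ} [NeZero d] {V : ℝ → Sphere d → ℝ → ℂ}
    (hV : ProfileAssumption V) {τ : ℝ} (hτ : 0 < τ) :
    MemLp (fun p : ℝ × Sphere d => V p.1 p.2 τ) 2 (profileMeasure d) := by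
  obtain ⟨h, -⟩ := hV.isProfileEvolution
  exact h ⟨τ, hτ⟩

theorem ProfileAssumption.integrable_pow_mul {d : ℕ} [NeZero d] {V : ℝ → Sphere d → ℝ → ℂ}
    (hV : ProfileAssumption V) {τ : ℝ} (hτ : 0 < τ) {j : ℕ} (hj : j + 1 ≤ d) :
    Integrable (fun p : ℝ × Sphere d => (p.1 : ℂ) ^ j * V p.1 p.2 τ) (profileMeasure d) := by
  obtain ⟨C, α, -, hα, h⟩ := hV.decay
  exact integrable_pow_mul_profile hα (hV.memLp hτ).1 (h τ hτ) hj

theorem ProfileAssumption.integrable {d : ℕ} [NeZero d] {V : ℝ → Sphere d → ℝ → ℂ}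
    (hV : ProfileAssumption V) {τ : ℝ} (hτ : 0 < τ) :
    Integrable (fun p : ℝ × Sphere d => V p.1 p.2 τ) (profileMeasure d) := by
  simpa using hV.integrable_pow_mul hτ (j := 0) (by simpa using NeZero.one_le)

/-- Asymptotics of the Fourier transform of the shell in terms of `T = ct`. -/
theorem tendsto_shell_oscillatory {d : ℕ} [NeZero d] (hd : d = 1 ∨ d = 2 ∨ d = 3)
    {V : ℝ → Sphere d → ℝ → ℂ} (hV : ProfileAssumption V)
    (hV_neg : ∀ (ξ : ℝ) (q : Sphere d) (τ : ℝ), ξ < 0 → 0 < τ → profileFourier V ξ q τ = 0)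
    {τ : ℝ} (hτ : 0 < τ) {k : Space d} (hk : k ≠ 0) :
    Tendsto (fun T : ℝ => Complex.exp (Complex.I * ((‖k‖ * T : ℝ) : ℂ)) *
      (((T ^ (((d : ℝ) - 1) / 2) : ℝ) : ℂ) * ∫ p, (shellWeight d T p.1 : ℂ) *
        (V p.1 p.2 τ * shellPhase k T p) ∂profileMeasure d)) atTop
      (𝓝 (((‖k‖ : ℂ) / (2 * Real.pi * Complex.I)) ^ (-(((d : ℂ) - 1) / 2)) *
        profileFourier V ‖k‖ (direction k hk) τ)) := by
  have hint := hV.integrable hτ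
  have hneg : ∀ ξ q, ξ < 0 → profileFourier V ξ q τ = 0 := fun ξ q hξ => hV_neg ξ q τ hξ hτ
  have hsm := hV.smooth τ hτ
  have hrem : Tendsto (fun T : ℝ => ((T ^ (((d : ℝ) - 1) / 2) : ℝ) : ℂ) *
      (∫ p, (shellWeight d T p.1 : ℂ) * (V p.1 p.2 τ * shellPhase k T p) ∂profileMeasure d -
        ∫ p, V p.1 p.2 τ * shellPhase k T p ∂profileMeasure d)) atTop (𝓝 0) := by
    rcases hd with rfl | rfl | rfl
    · exact tendsto_shellWeight_one hint k
    · exact tendsto_shellWeight_two hint (hV.integrable_pow_mul hτ (by norm_num)) k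
    · exact tendsto_shellWeight_three hint (hV.integrable_pow_mul hτ (by norm_num))
        (hV.integrable_pow_mul hτ (by norm_num)) hk
  have hmain : Tendsto (fun T : ℝ => Complex.exp (Complex.I * ((‖k‖ * T : ℝ) : ℂ)) *
      (((T ^ (((d : ℝ) - 1) / 2) : ℝ) : ℂ) * ∫ q : Sphere d,
        Complex.exp (-(Complex.I * ((T * inner ℝ k q : ℝ) : ℂ))) *
          profileFourier V (inner ℝ k q) q τ ∂surfaceMeasure d)) atTop
      (𝓝 (((‖k‖ : ℂ) / (2 * Real.pi * Complex.I)) ^ (-(((d : ℂ) - 1) / 2)) *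
        profileFourier V ‖k‖ (direction k hk) τ)) := by
    rcases hd with rfl | rfl | rfl
    · exact tendsto_sphere_integral_one (U := fun ξ q => profileFourier V ξ q τ) hneg hk
    · exact tendsto_sphere_integral_two (U := fun ξ q => profileFourier V ξ q τ) hsm hneg hk
    · exact tendsto_sphere_integral_three (U := fun ξ q => profileFourier V ξ q τ) hsm hneg hk
  have hrem' : Tendsto (fun T : ℝ => Complex.exp (Complex.I * ((‖k‖ * T : ℝ) : ℂ)) *
      (((T ^ (((d : ℝ) - 1) / 2) : ℝ) : ℂ) *
      (∫ p, (shellWeight d T p.1 : ℂ) * (V p.1 p.2 τ * shellPhase k T p) ∂profileMeasure d -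
        ∫ p, V p.1 p.2 τ * shellPhase k T p ∂profileMeasure d))) atTop (𝓝 0) := by
    rw [tendsto_zero_iff_norm_tendsto_zero] at hrem ⊢
    refine hrem.congr fun T => ?_
    rw [norm_mul (Complex.exp _), mul_comm Complex.I, Complex.norm_exp_ofReal_mul_I, one_mul]
  have hsum := hmain.add hrem'
  rw [add_zero] at hsum
  refine hsum.congr fun T => ?_
  rw [integral_mul_shellPhase hint k T]
  simp only [profileFourier]
  ring

/-- The measure-preserving shell coordinates transfer the estimates for `shellProfile` to ℝ^d. The
order of quantifiers matters: `B` depends on the slice at τ but not on ε. -/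
theorem exists_shell_bound {d : ℕ} [NeZero d] {c τ : ℝ} (hc : 0 < c) (hτ : 0 < τ)
    {V : ℝ → Sphere d → ℝ → ℂ} (hV : ProfileAssumption V) :
    ∃ B : ENNReal, B ≠ ⊤ ∧ ∀ ε : ℝ, 0 < ε →
      Integrable (fun x => shell c ε V x (τ / ε ^ 2)) volume ∧
      MemLp (fun x => shell c ε V x (τ / ε ^ 2)) 2 volume ∧
      eLpNorm (fun x => shell c ε V x (τ / ε ^ 2)) 2 volume ≤ B := by
  obtain ⟨q₀⟩ : Nonempty (Sphere d) := (NormedSpace.sphere_nonempty.2 zero_le_one).to_subtype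
  have hv := hV.memLp hτ
  have hBtop : ENNReal.ofReal (2 ^ (((d : ℝ) - 1) / 2)) *
      eLpNorm (fun p : ℝ × Sphere d => V p.1 p.2 τ) 2 (profileMeasure d) ≠ ⊤ :=
    ENNReal.mul_ne_top ENNReal.ofReal_ne_top hv.2.ne
  refine ⟨_, hBtop, fun ε hε => ?_⟩
  have hT : 0 < c * (τ / ε ^ 2) := by positivity
  have hmp := measurePreserving_shellCoord q₀ (c * (τ / ε ^ 2))
  have hae := shell_ae_eq q₀ c ε τ hε V
  have hm := aestronglyMeasurable_shellProfile hv.1 (c * (τ / ε ^ 2))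
  have hle := eLpNorm_shellProfile_le (v := fun p : ℝ × Sphere d => V p.1 p.2 τ) hT
  have hcomp := eLpNorm_comp_measurePreserving (p := 2) hm hmp
  have hnorm := ((eLpNorm_congr_ae (p := 2) hae).trans hcomp).le.trans hle
  exact ⟨((hmp.integrable_comp hm).2 (integrable_shellProfile (hV.integrable hτ) _)).congr hae.symm,
    ⟨(hm.comp_measurePreserving hmp).congr hae.symm, hnorm.trans_lt hBtop.lt_top⟩, hnorm⟩

end WaveShell

end

theorem theorem3p3 (d : ℕ) [NeZero d] (hd : d = 1 ∨ d = 2 ∨ d = 3) (c : ℝ) (hc : 0 < c)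
    (V : ℝ → WaveShell.Sphere d → ℝ → ℂ) (hV : WaveShell.ProfileAssumption V)
    (hV_neg : ∀ (ξ : ℝ) (q : WaveShell.Sphere d) (τ : ℝ), ξ < 0 → 0 < τ →
      WaveShell.profileFourier V ξ q τ = 0) :
    ∀ τ : ℝ, 0 < τ →
      (∀ ε : ℝ, 0 < ε → Integrable (fun x => WaveShell.shell c ε V x (τ / ε ^ 2)) volume) ∧
      (∀ (k : WaveShell.Space d) (hk : k ≠ 0),
        Tendsto
          (fun ε : ℝ =>
            WaveShell.spaceFourier (fun x => WaveShell.shell c ε V x (τ / ε ^ 2)) k *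
              Complex.exp (Complex.I * c * ‖k‖ * τ / ε ^ 2))
          (𝓝[>] 0)
          (𝓝 (((‖k‖ : ℂ) / (2 * Real.pi * Complex.I)) ^ (-(((d : ℂ) - 1) / 2)) *
            WaveShell.profileFourier V ‖k‖ (WaveShell.direction k hk) τ))) ∧
      WaveShell.WeaklyConvergesL2
        (fun ε k => WaveShell.shellFourier c ε V τ k) (WaveShell.shellLimit V τ) := by
  intro τ hτ
  obtain ⟨B, hB, hshell⟩ := WaveShell.exists_shell_bound hc hτ hV
  have hptwise : ∀ (k : WaveShell.Space d) (hk : k ≠ 0),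
      Tendsto (fun ε : ℝ =>
        WaveShell.spaceFourier (fun x => WaveShell.shell c ε V x (τ / ε ^ 2)) k *
          Complex.exp (Complex.I * c * ‖k‖ * τ / ε ^ 2)) (𝓝[>] 0)
        (𝓝 (((‖k‖ : ℂ) / (2 * Real.pi * Complex.I)) ^ (-(((d : ℂ) - 1) / 2)) *
          WaveShell.profileFourier V ‖k‖ (WaveShell.direction k hk) τ)) := by
    intro k hk
    refine ((WaveShell.tendsto_shell_oscillatory hd hV hV_neg hτ hk).comp
      (WaveShell.tendsto_shellTime hc hτ)).congr' ?_
    filter_upwards [self_mem_nhdsWithin] with ε hε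
    rw [WaveShell.spaceFourier_shell hc hε hτ (hV.memLp hτ).1 k rfl, mul_comm]
    simp only [Function.comp_apply]
    congr 2
    push_cast
    ring
  obtain ⟨K, hK, hF⟩ := WaveShell.exists_eLpNorm_spaceFourier_le d
  have hnorm : ∀ ε : ℝ, ∀ k : WaveShell.Space d,
      ‖Complex.exp (Complex.I * c * ‖k‖ * τ / ε ^ 2)‖ = 1 := by
    intro ε k
    rw [show Complex.I * c * ‖k‖ * τ / (ε : ℂ) ^ 2 =
      ((c * ‖k‖ * τ / ε ^ 2 : ℝ) : ℂ) * Complex.I by push_cast; ring]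
    exact Complex.norm_exp_ofReal_mul_I _
  have hmem : ∀ ε : ℝ, 0 < ε →
      MemLp (fun k => WaveShell.shellFourier c ε V τ k) 2 volume ∧
        eLpNorm (fun k => WaveShell.shellFourier c ε V τ k) 2 volume ≤ K * B := by
    intro ε hε
    obtain ⟨h1, h2, h3⟩ := hshell ε hε
    obtain ⟨h4, h5⟩ := hF _ h1 h2
    have hn : ∀ᵐ k : WaveShell.Space d, ‖WaveShell.shellFourier c ε V τ k‖ =
        ‖WaveShell.spaceFourier (fun x => WaveShell.shell c ε V x (τ / ε ^ 2)) k‖ :=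
      ae_of_all _ fun k => by rw [WaveShell.shellFourier, norm_mul, hnorm, mul_one]
    have hm : AEStronglyMeasurable (fun k => WaveShell.shellFourier c ε V τ k) volume :=
      h4.1.mul (Continuous.aestronglyMeasurable (by fun_prop))
    exact ⟨(memLp_congr_norm hm h4.1 hn).2 h4,
      (eLpNorm_congr_norm_ae hn).le.trans (h5.trans (by gcongr))⟩
  -- The value assigned to `shellLimit` at k = 0 is immaterial, as a point is null.
  have hlim : ∀ᵐ k : WaveShell.Space d,
      Tendsto (fun ε : ℝ => WaveShell.shellFourier c ε V τ k) (𝓝[>] 0)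
        (𝓝 (WaveShell.shellLimit V τ k)) := by
    have h0 : ∀ᵐ k : WaveShell.Space d, k ≠ 0 := by
      rw [ae_iff]; simp
    filter_upwards [h0] with k hk
    have hl : WaveShell.shellLimit V τ k =
        ((‖k‖ : ℂ) / (2 * Real.pi * Complex.I)) ^ (-(((d : ℂ) - 1) / 2)) *
          WaveShell.profileFourier V ‖k‖ (WaveShell.direction k hk) τ := by
      simp [WaveShell.shellLimit, hk]
    rw [hl]
    exact hptwise k hk
  have hpos : ∀ᶠ ε : ℝ in 𝓝[>] 0, 0 < ε := self_mem_nhdsWithin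
  obtain ⟨hG, hweak⟩ := WaveShell.weak_tendsto_of_ae_tendsto
    (F := fun ε k => WaveShell.shellFourier c ε V τ k) (ENNReal.mul_ne_top hK hB)
    (hpos.mono fun ε hε => (hmem ε hε).1) (hpos.mono fun ε hε => (hmem ε hε).2) hlim
  exact ⟨fun ε hε => (hshell ε hε).1, hptwise, fun ε hε => (hmem ε hε).1, hG, hweak⟩
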